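/- Let $k\ge 1$ and let $(A,[\cdot,\cdot],\rho)$ be a Lie algebroid over a coordinate domain with coordinates $(x^A)$, identified with an open set $U\subset\mathbb R^d$, with a frame $(e_a)_{a=1}^m$ and structure functions $\rho(e_a)=\rho_a^A(x)\,\partial_{x^A}$, $[e_a,e_b]=C_{ab}^c(x)\,e_c$ (summation convention). Let $A^k$ (with $A^0=U$) be the bundle of $(k-1)$-jets of admissible curves of $A$ (curves $(x(t),y(t))$ with $\dot x=\rho(x)y$), with the homogeneous coordinates $(x^A,y_1^a,\dots,y_k^a)$ in which the jet of $(x(t),y(t))$ is $x$, $y_j=\frac1{j!}\frac{d^{j-1}y}{dt^{j-1}}$; let $\tau:A^{k-1}\to U$ be the projection. Let $$D(A^k)=\{(Y,Z)\in A\times_U TA^{k-1}\mid \rho(Y)=T\tau(Z)\}\to A^{k-1},$$ with linear coordinates $Y_1=Y$ and $Y_{w+1}=\dot y_w(Z)$, $1\le w\le k-1$, with anchor $(Y,Z)\mapsto Z$ and with the bracket given on projectable sections by $[(s,Z),(s',Z')]=([s,s'],[Z,Z'])$, and let $\epsilon:T^*D(A^k)\to TD^*(A^k)$ be the corresponding double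 vector bundle morphism over the identity of the dual bundle $D^*(A^k)$. Let $\iota:A^k\hookrightarrow D(A^k)$, $Y_w=w\,y_w$, be the canonical embedding by holonomic vectors. For a smooth Lagrangian $L:A^k\to\mathbb R$ let $\mathcal PL$ be the relation that associates with $q\in A^k$ the covectors $\alpha\in T^*_{\iota(q)}D(A^k)$ with $\alpha\circ T_q\iota=dL(q)$, let $\Lambda_L=\epsilon\circ\mathcal PL$, and let $\mathcal D_L=\Lambda_L(A^k)\subset TD^*(A^k)$ be the phase dynamics. Write $\pi^{k+1-w}_a$ for the momentum dual to $Y_w^a$, and $\delta$ for the components of tangent vectors. All curves are over an open set $J\subset\mathbb R$. A smooth curve $\gamma$ in $A^k$ satisfies the Euler–Lagrange equations if it is $\Lambda_L$-related to the tangent prolongation of some smooth curve in $D^*(A^k)$. Then the following hold. 1. A point $q=(x,y_1,\dots,y_k)$ of $A^k$ is $\Lambda_L$-related to a tangent vector of $D^*(A^k)$ if and only if the base point of the latter in $A^{k-1}$ is $(x,y_1,\dots,y_{k-1})$ and $$\delta x^A=\rho_a^Ay_1^a,\qquad \delta y_w^a=(w+1)y_{w+1}^a\ (1\le w\le k-1),\qquad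 k\,\pi_a^1=\frac{\partial L}{\partial y_k^a},$$ $$\delta\pi_a^{k-w}=\frac{\partial L}{\partial y_w^a}-w\,\pi_a^{k+1-w}\ (1\le w\le k-1),\qquad \delta\pi_a^k=\rho_a^A\frac{\partial L}{\partial x^A}+y_1^bC_{ba}^c\,\pi_c^k .$$ 2. A curve $\beta$ in $D^*(A^k)$ is a solution of the phase dynamics, $(\beta,\dot\beta)\in\mathcal D_L$, if and only if some curve $\gamma$ in $A^k$ is $\Lambda_L$-related to $(\beta,\dot\beta)$. For a smooth $\beta$ and any curve $\gamma=(x,y_1,\dots,y_k)$ in $A^k$ this relation holds if and only if $\beta$ projects to $(x,y_1,\dots,y_{k-1})$, the curve $(x,y_1)$ is admissible, $y_j=\frac1{j!}\frac{d^{j-1}}{dt^{j-1}}y_1$ for $1\le j\le k$, the momenta of $\beta$ are the Jacobi–Ostrogradski momenta, given recursively by $$k\,\pi_a^1=\frac{\partial L}{\partial y_k^a},\qquad w\,\pi_a^{k+1-w}=\frac{\partial L}{\partial y_w^a}-\frac{d}{dt}\pi_a^{k-w}\quad(1\le w\le k-1)$$ and in closed form by $$\pi_a^{k-i}=\sum_{j=i+1}^{k}(-1)^{j-i-1}\frac{i!}{j!}\frac{d^{\,j-i-1}}{dt^{\,j-i-1}}\frac{\partial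 L}{\partial y_j^a}\quad(0\le i\le k-1),$$ and $\dfrac{d}{dt}\pi_a^k=\rho_a^A\dfrac{\partial L}{\partial x^A}+y_1^bC_{ba}^c\,\pi_c^k$. 3. A smooth curve $\gamma=(x,y_1,\dots,y_k)$ in $A^k$ satisfies the Euler–Lagrange equations if and only if $(x,y_1)$ is admissible, $y_j=\frac1{j!}\frac{d^{j-1}}{dt^{j-1}}y_1$ for $1\le j\le k$, and the $k$-th order Euler–Lagrange equations $$\rho_a^A\frac{\partial L}{\partial x^A}-\Big(\delta_a^c\frac{d}{dt}-y_1^bC_{ba}^c\Big)\Big(\sum_{j=1}^k(-1)^{j+1}\frac1{j!}\frac{d^{\,j-1}}{dt^{\,j-1}}\frac{\partial L}{\partial y_j^c}\Big)=0$$ hold for all $a$. 4. If $A=TU$, so that $A^k=T^kU$, and $L(x,y_1,\dots,y_k)=\mathcal L(x,1!\,y_1,\dots,k!\,y_k)$ with a smooth $\mathcal L=\mathcal L(q,\dot q,\dots,q^{(k)})$, then a smooth curve $\gamma$ satisfies the Euler–Lagrange equations if and only if $j!\,y_j=x^{(j)}$ for $1\le j\le k$ and the higher-order Euler–Lagrange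 equations $\sum_{j=0}^k(-1)^j\frac{d^j}{dt^j}\frac{\partial\mathcal L}{\partial q^{(j)}}(x,\dot x,\dots,x^{(k)})=0$ hold. 5. If $A$ is a finite-dimensional real Lie algebra with basis $(e_a)$, $[e_a,e_b]=c_{ab}^ce_c$, regarded as a Lie algebroid over a point, and $L(y_1,\dots,y_k)=\ell(1!\,y_1,\dots,k!\,y_k)$ with a smooth $\ell=\ell(\xi,\dot\xi,\dots,\xi^{(k-1)})$, then a smooth curve $\gamma$ satisfies the Euler–Lagrange equations if and only if, with $\xi=y_1$, $j!\,y_j=\xi^{(j-1)}$ for $1\le j\le k$ and the higher-order Euler–Poincaré equations $$\frac{d}{dt}\mu_a=\xi^bc_{ba}^c\,\mu_c,\qquad \mu_a=\sum_{j=0}^{k-1}(-1)^j\frac{d^j}{dt^j}\frac{\partial\ell}{\partial(\xi^{(j)})^a}(\xi,\dot\xi,\dots,\xi^{(k-1)}),$$ hold. -/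

import Mathlib

open Set
open scoped ContDiff

noncomputable section

namespace LieAlgebroidMechanics

section General

variable {E V : Type*} [NormedAddCommGroup E] [NormedSpace ℝ E]
  [NormedAddCommGroup V] [NormedSpace ℝ V]

/-- A (smooth) Lie algebroid with typical fibre `V` over an open set `U` of a normed space `E`
(a Lie algebroid over a coordinate domain, trivialised by a local frame).
A section is a map `s : E → V` that is smooth on `U`; only its values on `U` matter. -/
structure LieAlgebroid (U : Set E) (V : Type*) [NormedAddCommGroup V] [NormedSpace ℝ V] where
  /-- the anchor, a vector bundle morphism to the tangent bundle -/
  anchor : E → V →L[ℝ] E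
  anchor_smooth : ContDiffOn ℝ ∞ anchor U
  /-- the bracket of sections -/
  bracket : (E → V) → (E → V) → E → V
  bracket_smooth : ∀ s t, ContDiffOn ℝ ∞ s U → ContDiffOn ℝ ∞ t U →
    ContDiffOn ℝ ∞ (bracket s t) U
  bracket_congr : ∀ s s' t t', ContDiffOn ℝ ∞ s U → ContDiffOn ℝ ∞ t U →
    EqOn s s' U → EqOn t t' U → EqOn (bracket s t) (bracket s' t') U
  bracket_add : ∀ s t t', ContDiffOn ℝ ∞ s U → ContDiffOn ℝ ∞ t U → ContDiffOn ℝ ∞ t' U →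
    ∀ x ∈ U, bracket s (t + t') x = bracket s t x + bracket s t' x
  bracket_skew : ∀ s t, ContDiffOn ℝ ∞ s U → ContDiffOn ℝ ∞ t U →
    ∀ x ∈ U, bracket s t x = - bracket t s x
  leibniz : ∀ (s t : E → V) (f : E → ℝ), ContDiffOn ℝ ∞ s U → ContDiffOn ℝ ∞ t U →
    ContDiffOn ℝ ∞ f U → ∀ x ∈ U,
      bracket s (fun z => f z • t z) x
        = f x • bracket s t x + (fderiv ℝ f x (anchor x (s x))) • t x
  jacobi : ∀ s t u, ContDiffOn ℝ ∞ s U → ContDiffOn ℝ ∞ t U → ContDiffOn ℝ ∞ u U →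
    ∀ x ∈ U, bracket s (bracket t u) x = bracket (bracket s t) u x + bracket t (bracket s u) x
  anchor_bracket : ∀ s t, ContDiffOn ℝ ∞ s U → ContDiffOn ℝ ∞ t U →
    ∀ x ∈ U, anchor x (bracket s t x)
      = VectorField.lieBracket ℝ (fun z => anchor z (s z)) (fun z => anchor z (t z)) x

/-- The space of homogeneous coordinates `(x, y₁, …, y_k)` of the `k`-th order bundle `A^k`, the
bundle of `(k-1)`-jets of admissible curves of `A`; the component `y j` (`j : Fin k`) is the
coordinate `y_{j+1}`, of weight `j + 1`.  The jet at `t` of an admissible curve `(x, y)` has the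
coordinates `x(t)` and `y_{j+1} = y^{(j)}(t) / (j+1)!`, see `jet`. -/
abbrev JetSpace (E V : Type*) (k : ℕ) := E × (Fin k → V)

/-- The bundle `A^k` over `U`. -/
def jetBundle (U : Set E) (V : Type*) (k : ℕ) : Set (JetSpace E V k) := {q | q.1 ∈ U}

/-- Homogeneous coordinates of the `(k-1)`-jet at `t` of a curve in `A`. -/
def jet (k : ℕ) (a : ℝ → E × V) (t : ℝ) : JetSpace E V k :=
  ((a t).1, fun j => (1 / (((j : ℕ) + 1).factorial : ℝ)) • iteratedDeriv j (fun s => (a s).2) t)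

/-- A curve `a = (x, y)` in `A` is admissible over `J` if `x' = ρ(x) y` there. -/
def IsAdmissible {U : Set E} (A : LieAlgebroid U V) (J : Set ℝ) (a : ℝ → E × V) : Prop :=
  ∀ t ∈ J, HasDerivAt (fun s => (a s).1) (A.anchor (a t).1 (a t).2) t

/-! In what follows the order is `k = n + 1`, so that `A^{k-1}` has coordinates in
`JetSpace E V n`. -/

/-- The fibre over `p ∈ A^{k-1}` of `D(A^k) = {(Y, Z) ∈ A ×_M T A^{k-1} | ρ(Y) = Tτ(Z)}`. -/
def prolongation {U : Set E} (A : LieAlgebroid U V) {n : ℕ} (p : JetSpace E V n) :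
    Submodule ℝ (V × JetSpace E V n) where
  carrier := {w | A.anchor p.1 w.1 = w.2.1}
  add_mem' := by
    intro a b ha hb
    simp only [mem_ofPred_eq, Prod.fst_add, Prod.snd_add, map_add] at *
    rw [ha, hb]
  zero_mem' := by simp
  smul_mem' := by
    intro c a ha
    simp only [mem_ofPred_eq, Prod.smul_fst, Prod.smul_snd, map_smul] at *
    rw [ha]

/-- The anchor `ρ_D : D(A^k) → T A^{k-1}`, `(Y, Z) ↦ Z`, in the linear fibre coordinates
`Y = (Y₁, …, Y_k)` of `prolongationEquiv`. -/
def prolAnchor {U : Set E} (A : LieAlgebroid U V) {n : ℕ} (p : JetSpace E V n) :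
    (Fin (n + 1) → V) →L[ℝ] JetSpace E V n :=
  ((A.anchor p.1).comp (ContinuousLinearMap.proj 0)).prod
    (ContinuousLinearMap.pi fun w : Fin n => ContinuousLinearMap.proj w.succ)

/-- The linear coordinates `(Y₁, …, Y_k)` on the fibres of `D(A^k)`: `Y₁` is the component in `A`
and `Y_{w+1}` is the component of `Z` along `y_w`. -/
def prolongationEquiv {U : Set E} (A : LieAlgebroid U V) {n : ℕ} (p : JetSpace E V n) :
    (Fin (n + 1) → V) ≃ₗ[ℝ] prolongation A p where
  toFun Y := ⟨(Y 0, prolAnchor A p Y), rfl⟩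
  map_add' Y Y' := by
    apply Subtype.ext
    simp
  map_smul' c Y := by
    apply Subtype.ext
    simp
  invFun w := Fin.cons w.1.1 w.1.2.2
  left_inv Y := by
    funext j
    refine Fin.cases ?_ (fun i => ?_) j <;> simp [prolAnchor]
  right_inv w := by
    obtain ⟨⟨a, b, c⟩, hw⟩ := w
    apply Subtype.ext
    refine Prod.ext (by simp) (Prod.ext ?_ ?_)
    · change A.anchor p.1 a = b at hw
      simpa [prolAnchor] using hw
    · funext i
      simp [prolAnchor]

/-- Coordinates of the total space of `D(A^k) → A^{k-1}`. -/
abbrev DSpace (E V : Type*) (n : ℕ) := JetSpace E V n × (Fin (n + 1) → V)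

/-- Coordinates of the total space of the dual bundle `D^*(A^k) → A^{k-1}`, the phase space. -/
abbrev DDualSpace (E V : Type*) [NormedAddCommGroup V] [NormedSpace ℝ V] (n : ℕ) :=
  JetSpace E V n × ((Fin (n + 1) → V) →L[ℝ] ℝ)

/-- The canonical embedding `A^k → D(A^k)` by holonomic vectors, `Y_w = w y_w`; it sends the jet at
`0` of an admissible curve `a` to the pair of `a 0` and of the velocity at `0` of the curve of
`(k-2)`-jets of `a`. -/
def holonomic {n : ℕ} (q : JetSpace E V (n + 1)) : DSpace E V n :=
  ((q.1, fun w => q.2 w.castSucc), fun j => (((j : ℕ) : ℝ) + 1) • q.2 j)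

/-- `holonomic` is indeed the pair of the curve and of the velocity of its lower jet. -/
theorem holonomic_jet {U : Set E} (A : LieAlgebroid U V) {n : ℕ} (a : ℝ → E × V) (t : ℝ)
    (hy : ContDiff ℝ ∞ fun s => (a s).2)
    (ha : HasDerivAt (fun s => (a s).1) (A.anchor (a t).1 (a t).2) t) :
    (holonomic (jet (n + 1) a t)).1 = jet n a t ∧
    (holonomic (jet (n + 1) a t)).2 0 = (a t).2 ∧
    HasDerivAt (jet n a) (prolAnchor A (jet n a t) (holonomic (jet (n + 1) a t)).2) t := by
  have h0 : (holonomic (jet (n + 1) a t)).2 0 = (a t).2 := by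
    simp [holonomic, jet]
  refine ⟨by simp [holonomic, jet], h0, ?_⟩
  refine HasDerivAt.prodMk ?_ ?_
  · change HasDerivAt _ (A.anchor _ ((holonomic (jet (n + 1) a t)).2 0)) t
    rw [h0]
    exact ha
  · rw [hasDerivAt_pi]
    intro w
    have hd : Differentiable ℝ (iteratedDeriv (w : ℕ) fun s => (a s).2) :=
      hy.differentiable_iteratedDeriv _ (by exact_mod_cast ENat.natCast_lt_top _)
    have h1 := (hd t).hasDerivAt.const_smul (1 / (((w : ℕ) + 1).factorial : ℝ))
    rw [← iteratedDeriv_succ] at h1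
    refine HasDerivAt.congr_deriv h1 (Eq.symm ?_)
    change (((w.succ : Fin (n + 1)) : ℕ) + 1 : ℝ) • (1 / (((w.succ : ℕ) + 1).factorial : ℝ)) •
      iteratedDeriv (w.succ : ℕ) (fun s => (a s).2) t = _
    rw [smul_smul, Fin.val_succ]
    congr 1
    rw [Nat.factorial_succ ((w : ℕ) + 1)]
    have : (((w : ℕ) + 1).factorial : ℝ) ≠ 0 := by positivity
    push_cast
    field_simp

/-- `σ` is a projectable section of `D(A^k)` over the section `s` of `A`: it is smooth, and its
component in `A` is `s ∘ τ`. -/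
structure IsProjectable (U : Set E) {n : ℕ} (s : E → V)
    (σ : JetSpace E V n → Fin (n + 1) → V) : Prop where
  smooth_base : ContDiffOn ℝ ∞ s U
  smooth : ContDiffOn ℝ ∞ σ (jetBundle U V n)
  proj : ∀ p ∈ jetBundle U V n, σ p 0 = s p.1

/-- The bracket of the projectable sections `σ = (s, Z)`, `σ' = (s', Z')` of `D(A^k)`:
`[σ, σ'] = ([s, s']_A, [Z, Z'])` with the Lie bracket of vector fields on `A^{k-1}`. -/
def prolBracket {U : Set E} (A : LieAlgebroid U V) {n : ℕ} (s s' : E → V)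
    (σ σ' : JetSpace E V n → Fin (n + 1) → V) (p : JetSpace E V n) : Fin (n + 1) → V :=
  Fin.cons (A.bracket s s' p.1)
    (VectorField.lieBracket ℝ (fun z => prolAnchor A z (σ z)) (fun z => prolAnchor A z (σ' z)) p).2

/-- The algebroid structure `ε : T^* D(A^k) → T D^*(A^k)`, as a relation: `(b, v) = ε(d, α)` for
`α ∈ T^*_d D(A^k)` and `v ∈ T_b D^*(A^k)`.  The map `ε` covers the identity of `D^*(A^k)` (`α`
restricted to the fibre is `b`) and the anchor, and the derivative along `ε(α)` of the function
`ι_X(p, ξ) = ξ (X p)` defined by a section `X` is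
`ξ ([Y, X] p) + α (TY (ρ_D (X p)))`, where `Y` is any section through `d`; in other words, it is
the value of `α` on the complete lift of `X` at `d`.  It suffices to take projectable `X`, `Y`. -/
structure IsEpsilon {U : Set E} (A : LieAlgebroid U V) {n : ℕ} (d : DSpace E V n)
    (α : DSpace E V n →L[ℝ] ℝ) (b v : DDualSpace E V n) : Prop where
  base : b.1 = d.1
  fibre : ∀ w : Fin (n + 1) → V, b.2 w = α (0, w)
  anchor : v.1 = prolAnchor A d.1 d.2
  bracket : ∀ (s s' : E → V) (σ σ' : JetSpace E V n → Fin (n + 1) → V),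
    IsProjectable U s σ → IsProjectable U s' σ' → σ d.1 = d.2 →
      v.2 (σ' d.1) + b.2 (fderiv ℝ σ' d.1 v.1)
        = b.2 (prolBracket A s s' σ σ' d.1)
          + α (prolAnchor A d.1 (σ' d.1), fderiv ℝ σ d.1 (prolAnchor A d.1 (σ' d.1)))

/-- The relation `𝒫L : A^k → T^* D(A^k)` of the vakonomic constraint `S = ι(A^k) ⊂ D(A^k)`: the
covector `α` at `d = ι(q)` is related to `q` if its restriction to `T_d S` is `dL`. The set of these
`α` is the lagrangian submanifold `S_L`. -/
def IsVakonomic {n : ℕ} (L : JetSpace E V (n + 1) → ℝ) (q : JetSpace E V (n + 1))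
    (d : DSpace E V n) (α : DSpace E V n →L[ℝ] ℝ) : Prop :=
  d = holonomic q ∧ ∀ w : JetSpace E V (n + 1), α (fderiv ℝ holonomic q w) = fderiv ℝ L q w

/-- The weighted Tulczyjew differential `Λ_L = ε ∘ 𝒫L`, a relation from `A^k` to `T D^*(A^k)`. A
tangent vector of `D^*(A^k)` is a pair of a point `b` and a vector `v`. -/
def IsTulczyjewRelated {U : Set E} (A : LieAlgebroid U V) {n : ℕ}
    (L : JetSpace E V (n + 1) → ℝ) (q : JetSpace E V (n + 1)) (b v : DDualSpace E V n) : Prop :=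
  q ∈ jetBundle U V (n + 1) ∧ ∃ d α, IsVakonomic L q d α ∧ IsEpsilon A d α b v

/-- The phase dynamics `𝒟_L = Λ_L(A^k) ⊂ T D^*(A^k)`. -/
def phaseDynamics {U : Set E} (A : LieAlgebroid U V) {n : ℕ}
    (L : JetSpace E V (n + 1) → ℝ) : Set (DDualSpace E V n × DDualSpace E V n) :=
  {bv | ∃ q, IsTulczyjewRelated A L q bv.1 bv.2}

/-- The curve `γ` in `A^k` is `Λ_L`-related over `J` to the tangent prolongation of `β`. -/
def IsRelatedToProlongation {U : Set E} (A : LieAlgebroid U V) {n : ℕ}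
    (L : JetSpace E V (n + 1) → ℝ) (J : Set ℝ) (γ : ℝ → JetSpace E V (n + 1))
    (β : ℝ → DDualSpace E V n) : Prop :=
  ∀ t ∈ J, IsTulczyjewRelated A L (γ t) (β t) (deriv β t)

/-- The curve `γ` in `A^k` satisfies the Euler–Lagrange equations over `J`: it is `Λ_L`-related to
an admissible curve of `T D^*(A^k)`, that is, to the tangent prolongation of a smooth curve of
`D^*(A^k)`. -/
def SatisfiesEulerLagrange {U : Set E} (A : LieAlgebroid U V) {n : ℕ}
    (L : JetSpace E V (n + 1) → ℝ) (J : Set ℝ) (γ : ℝ → JetSpace E V (n + 1)) : Prop :=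
  ∃ β : ℝ → DDualSpace E V n, ContDiffOn ℝ ∞ β J ∧ IsRelatedToProlongation A L J γ β

/-- The canonical Lie algebroid `T U`. -/
def tangentAlgebroid {U : Set E} (hU : IsOpen U) : LieAlgebroid U E where
  anchor _ := ContinuousLinearMap.id ℝ E
  anchor_smooth := contDiffOn_const
  bracket s t := VectorField.lieBracket ℝ s t
  bracket_smooth s t hs ht := by
    have h := hs.lieBracketWithin_vectorField (m := ∞) ht hU.uniqueDiffOn (by simp)
    exact h.congr fun x hx => (VectorField.lieBracketWithin_of_isOpen hU hx).symm
  bracket_congr s s' t t' _ _ h h' x hx :=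
    Filter.EventuallyEq.lieBracket_vectorField_eq
      (Filter.eventuallyEq_of_mem (hU.mem_nhds hx) h)
      (Filter.eventuallyEq_of_mem (hU.mem_nhds hx) h')
  bracket_add s t t' _ ht ht' x hx :=
    VectorField.lieBracket_add_right
      ((ht.contDiffAt (hU.mem_nhds hx)).differentiableAt (by simp))
      ((ht'.contDiffAt (hU.mem_nhds hx)).differentiableAt (by simp))
  bracket_skew s t _ _ x _ := by
    rw [VectorField.lieBracket_swap]
  leibniz s t f _ ht hf x hx := by
    have := VectorField.lieBracket_smul_right (V := s)
      ((hf.contDiffAt (hU.mem_nhds hx)).differentiableAt (by simp))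
      ((ht.contDiffAt (hU.mem_nhds hx)).differentiableAt (by simp))
    simpa [add_comm] using this
  jacobi s t u hs ht hu x hx :=
    VectorField.leibniz_identity_lieBracket (n := ∞)
      (by rw [minSmoothness_of_isRCLikeNormedField]; exact WithTop.coe_le_coe.2 le_top)
      (hs.contDiffAt (hU.mem_nhds hx)) (ht.contDiffAt (hU.mem_nhds hx))
      (hu.contDiffAt (hU.mem_nhds hx))
  anchor_bracket s t _ _ x _ := rfl

end General

/-! ### Local coordinates

`x = (x^A)` on `U ⊂ ℝ^d`, and the frame `(e_a)` of `A = U × ℝ^m`. -/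

section Coordinates

variable {d m : ℕ}

/-- The anchor coefficient `ρ_a^A(x)`. -/
def rhoCoeff {U : Set (Fin d → ℝ)} (A : LieAlgebroid U (Fin m → ℝ)) (x : Fin d → ℝ)
    (a : Fin m) (i : Fin d) : ℝ :=
  A.anchor x (Pi.single a 1) i

/-- The structure function `C_{ab}^c(x)`, given by `[e_a, e_b] = C_{ab}^c e_c`. -/
def structureCoeff {U : Set (Fin d → ℝ)} (A : LieAlgebroid U (Fin m → ℝ)) (x : Fin d → ℝ)
    (a b c : Fin m) : ℝ :=
  A.bracket (fun _ => Pi.single a 1) (fun _ => Pi.single b 1) x c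

/-- `∂L/∂x^A` at `q ∈ A^k`. -/
def dLdx {k : ℕ} (L : JetSpace (Fin d → ℝ) (Fin m → ℝ) k → ℝ)
    (q : JetSpace (Fin d → ℝ) (Fin m → ℝ) k) (i : Fin d) : ℝ :=
  fderiv ℝ L q (Pi.single i 1, 0)

/-- `∂L/∂y_{j+1}^a` at `q ∈ A^k`. -/
def dLdy {k : ℕ} (L : JetSpace (Fin d → ℝ) (Fin m → ℝ) k → ℝ)
    (q : JetSpace (Fin d → ℝ) (Fin m → ℝ) k) (j : Fin k) (a : Fin m) : ℝ :=
  fderiv ℝ L q (0, Pi.single j (Pi.single a 1))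

/-- The component along `Y_{j+1}^a` of an element of the dual of the fibre of `D(A^k)`. With
`k = n + 1` this is the momentum `π_a^{k-j}`, and `δπ_a^{k-j+1}` for tangent vectors. -/
def momentum {n : ℕ} (ξ : (Fin (n + 1) → Fin m → ℝ) →L[ℝ] ℝ) (j : Fin (n + 1)) (a : Fin m) : ℝ :=
  ξ (Pi.single j (Pi.single a 1))

/-- The Jacobi–Ostrogradski expression for `π_c^{k-i}` along the curve `γ` in `A^k`,
`∑_{j = i+1}^{k} (-1)^{j-i-1} (i!/j!) d^{j-i-1}/dt^{j-i-1} ∂L/∂y_j^c`. For `i = 0` it is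
`π_c^k = ∑_{j = 1}^k (-1)^{j+1} (1/j!) d^{j-1}/dt^{j-1} ∂L/∂y_j^c`. (In the code `j` is shifted
by one.) -/
def jacobiOstrogradski {n : ℕ} (L : JetSpace (Fin d → ℝ) (Fin m → ℝ) (n + 1) → ℝ)
    (γ : ℝ → JetSpace (Fin d → ℝ) (Fin m → ℝ) (n + 1)) (i : Fin (n + 1)) (c : Fin m) (t : ℝ) : ℝ :=
  ∑ j ∈ Finset.Ici i, (-1 : ℝ) ^ ((j : ℕ) - (i : ℕ)) *
    (((i : ℕ).factorial : ℝ) / (((j : ℕ) + 1).factorial : ℝ)) *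
    iteratedDeriv ((j : ℕ) - (i : ℕ)) (fun τ => dLdy L (γ τ) j c) t

/-- A finite-dimensional real Lie algebra with a basis, as a Lie algebroid over a point. -/
def ofLieAlgebra {𝔤 : Type*} [LieRing 𝔤] [LieAlgebra ℝ 𝔤] (e : Module.Basis (Fin m) ℝ 𝔤) :
    LieAlgebroid (univ : Set (Fin 0 → ℝ)) (Fin m → ℝ) where
  anchor _ := 0
  anchor_smooth := contDiffOn_const
  bracket s t x := e.equivFun ⁅e.equivFun.symm (s x), e.equivFun.symm (t x)⁆
  bracket_smooth s t _ _ := by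
    rw [show (fun x : Fin 0 → ℝ => e.equivFun ⁅e.equivFun.symm (s x), e.equivFun.symm (t x)⁆) =
      fun _ => e.equivFun ⁅e.equivFun.symm (s 0), e.equivFun.symm (t 0)⁆ from
      funext fun x => by rw [Subsingleton.elim x 0]]
    exact contDiffOn_const
  bracket_congr s s' t t' _ _ h h' x hx := by simp only [h hx, h' hx]
  bracket_add s t t' _ _ _ x _ := by simp only [Pi.add_apply, map_add, lie_add]
  bracket_skew s t _ _ x _ := by rw [← lie_skew, map_neg]
  leibniz s t f _ _ _ x _ := by 
    have h : (0 : (Fin m → ℝ) →L[ℝ] (Fin 0 → ℝ)) (s x) = 0 := rfl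
    simp only [map_smul, lie_smul, h, map_zero, zero_smul, add_zero]
  jacobi s t u _ _ _ x _ := by
    simp only [LinearEquiv.symm_apply_apply]
    rw [leibniz_lie, map_add]
  anchor_bracket s t _ _ x _ := Subsingleton.elim _ _

end Coordinates

end LieAlgebroidMechanics

end

open LieAlgebroidMechanics

namespace LieAlgebroidMechanics

/-! ### Additivity of the bracket and its restriction to constant sections. -/

section Bracket

variable {E V : Type*} [NormedAddCommGroup E] [NormedSpace ℝ E]
  [NormedAddCommGroup V] [NormedSpace ℝ V] {U : Set E}

/-! Both halves of `Λ_L = ε ∘ 𝒫L` become explicit once a covector `α` at `ι(q)` is split into its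
fibre part `π` and the rest. Vectors tangent to `ι(A^k)` project onto `T A^{k-1}`, and the kernel of
this projection is the `y_k` direction, which `ι` sends to `k` times the `Y_k` direction. So a
covector with given `π` that restricts to `dL` exists exactly when `k π^1 = ∂L/∂y_k`, and it is then
unique (`isVakonomic_iff`).

For `ε`, the bracket of two projectable sections at a point depends only on their values and first
derivatives (`prolBracket_eq`). In the defining identity of `ε` the derivative terms cancel, so
constant sections suffice as tests: `δπ(Y) = π([Y(d), Y]) + α(ρ_D Y, 0)`, where only the first slots
enter the bracket (`isEpsilon_iff`). Evaluating on the frame gives the coordinate form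
`isTulczyjewRelated_iff`.

Along a curve `δ` is `d/dt`. The base equations say that `γ` consists of jets of an admissible
curve; the momentum equations form a triangular system, solved from `π^1` up to `π^k` by the
Jacobi–Ostrogradski sums; the equation for `π^k` remains. Conversely, for smooth `γ` these sums
define a smooth `β`. This gives the Euler–Lagrange equations (`satisfiesEulerLagrange_iff`). In the
two special cases the chain rule yields factors `j!` that cancel the weights `1/j!`. -/

theorem LieAlgebroid.bracket_zero_right (A : LieAlgebroid U V) {s : E → V}
    (hs : ContDiffOn ℝ ∞ s U) {x : E} (hx : x ∈ U) : A.bracket s 0 x = 0 := by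
  have h0 : ContDiffOn ℝ ∞ (0 : E → V) U := contDiffOn_const
  have h := A.bracket_add s 0 0 hs h0 h0 x hx
  rw [add_zero] at h
  simpa using h

theorem LieAlgebroid.bracket_sum_right (A : LieAlgebroid U V) {s : E → V}
    (hs : ContDiffOn ℝ ∞ s U) {ι : Type*} (F : Finset ι) {t : ι → E → V}
    (ht : ∀ i, ContDiffOn ℝ ∞ (t i) U) {x : E} (hx : x ∈ U) :
    A.bracket s (∑ i ∈ F, t i) x = ∑ i ∈ F, A.bracket s (t i) x := by
  classical
  induction F using Finset.induction_on with
  | empty => simpa using A.bracket_zero_right hs hx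
  | insert i F hi ih =>
    have hF : ContDiffOn ℝ ∞ (∑ j ∈ F, t j) U := by
      have : (∑ j ∈ F, t j) = fun x => ∑ j ∈ F, t j x := by
        ext x
        simp
      rw [this]
      exact ContDiffOn.sum fun j _ => ht j
    rw [Finset.sum_insert hi, Finset.sum_insert hi, A.bracket_add s _ _ hs (ht i) hF x hx, ih]

/-- The bracket of two constant sections at a point, as a linear map of the second one. -/
def LieAlgebroid.constBracket (A : LieAlgebroid U V) {x : E} (hx : x ∈ U) (u : V) :
    V →ₗ[ℝ] V where
  toFun v := A.bracket (fun _ => u) (fun _ => v) x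
  map_add' v w :=
    A.bracket_add (fun _ => u) (fun _ => v) (fun _ => w) contDiffOn_const contDiffOn_const
      contDiffOn_const x hx
  map_smul' r v := by
    -- With a constant coefficient the anchor term of the Leibniz rule vanishes.
    have := A.leibniz (fun _ => u) (fun _ => v) (fun _ => r) contDiffOn_const contDiffOn_const
      contDiffOn_const x hx
    simpa using this

theorem LieAlgebroid.constBracket_apply (A : LieAlgebroid U V) {x : E} (hx : x ∈ U) (u v : V) :
    A.constBracket hx u v = A.bracket (fun _ => u) (fun _ => v) x := rfl

theorem LieAlgebroid.constBracket_skew (A : LieAlgebroid U V) {x : E} (hx : x ∈ U) (u v : V) :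
    A.constBracket hx u v = - A.constBracket hx v u :=
  A.bracket_skew _ _ contDiffOn_const contDiffOn_const x hx

end Bracket

/-! ### Brackets expressed through values and first derivatives of sections. -/

section Frame

variable {E : Type*} [NormedAddCommGroup E] [NormedSpace ℝ E] {m : ℕ} {U : Set E}

/-- Expand `t` in the constant frame and apply Leibniz: one part uses only `t x`, the other
differentiates `t` along the anchor. The same expansion for the constant section with value `t x`
has no derivative part, so comparing the two gives the formula. -/
theorem LieAlgebroid.bracket_eq_right (A : LieAlgebroid U (Fin m → ℝ)) (hU : IsOpen U)
    {s t : E → Fin m → ℝ} (hs : ContDiffOn ℝ ∞ s U) (ht : ContDiffOn ℝ ∞ t U) {x : E}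
    (hx : x ∈ U) :
    A.bracket s t x = A.bracket s (fun _ => t x) x + fderiv ℝ t x (A.anchor x (s x)) := by
  have key : ∀ t : E → Fin m → ℝ, ContDiffOn ℝ ∞ t U → A.bracket s t x =
      ∑ a, t x a • A.bracket s (fun _ => Pi.single a 1) x + fderiv ℝ t x (A.anchor x (s x)) := by
    intro t ht
    have hd : DifferentiableAt ℝ t x :=
      (ht.contDiffAt (hU.mem_nhds hx)).differentiableAt (by simp)
    have hc : ∀ a, ContDiffOn ℝ ∞ (fun z => t z a) U := fun a => contDiffOn_pi.1 ht a
    have h1 : t = ∑ a, fun z => t z a • (Pi.single a (1 : ℝ) : Fin m → ℝ) := by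
      ext z c
      simp [Finset.sum_apply, Pi.single_apply]
    conv_lhs => rw [h1]
    rw [A.bracket_sum_right hs _ (t := fun a z => t z a • (Pi.single a (1 : ℝ) : Fin m → ℝ))
      (fun a => (hc a).smul contDiffOn_const) hx]
    have h2 : ∀ a, A.bracket s (fun z => t z a • (Pi.single a (1 : ℝ) : Fin m → ℝ)) x =
        t x a • A.bracket s (fun _ => Pi.single a 1) x +
          (fderiv ℝ t x (A.anchor x (s x)) a) • (Pi.single a (1 : ℝ) : Fin m → ℝ) := by
      intro a
      have h3 : fderiv ℝ (fun z => t z a) x (A.anchor x (s x)) =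
          fderiv ℝ t x (A.anchor x (s x)) a := by
        rw [fderiv_apply hd]
        rfl
      rw [A.leibniz s (fun _ => Pi.single a 1) (fun z => t z a) hs contDiffOn_const (hc a) x hx,
        h3]
    simp only [h2, Finset.sum_add_distrib]
    congr 1
    ext c
    simp [Finset.sum_apply, Pi.single_apply]
  rw [key t ht, key (fun _ => t x) contDiffOn_const]
  simp

/-- The bracket of two sections at a point, in terms of their values and derivatives. -/
theorem LieAlgebroid.bracket_eq (A : LieAlgebroid U (Fin m → ℝ)) (hU : IsOpen U)
    {s t : E → Fin m → ℝ} (hs : ContDiffOn ℝ ∞ s U) (ht : ContDiffOn ℝ ∞ t U) {x : E}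
    (hx : x ∈ U) :
    A.bracket s t x = A.constBracket hx (s x) (t x) + fderiv ℝ t x (A.anchor x (s x)) -
      fderiv ℝ s x (A.anchor x (t x)) := by
  -- Freeze the second argument, exchange the arguments by skew symmetry, and freeze the other one.
  rw [A.bracket_eq_right hU hs ht hx, A.bracket_skew s _ hs contDiffOn_const x hx,
    A.bracket_eq_right hU contDiffOn_const hs hx, ← A.constBracket_apply hx,
    A.constBracket_skew hx (s x)]
  abel

/-- The bracket of projectable sections of the prolongation, in terms of their values and
derivatives. -/
theorem prolBracket_eq (A : LieAlgebroid U (Fin m → ℝ)) (hU : IsOpen U) {n : ℕ}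
    {s s' : E → Fin m → ℝ} {σ σ' : JetSpace E (Fin m → ℝ) n → Fin (n + 1) → Fin m → ℝ}
    (hσ : IsProjectable U s σ) (hσ' : IsProjectable U s' σ') {p : JetSpace E (Fin m → ℝ) n}
    (hp : p.1 ∈ U) :
    prolBracket A s s' σ σ' p =
      Pi.single 0 (A.constBracket hp (σ p 0) (σ' p 0)) +
        fderiv ℝ σ' p (prolAnchor A p (σ p)) - fderiv ℝ σ p (prolAnchor A p (σ' p)) := by
  have hJ : IsOpen (jetBundle U (Fin m → ℝ) n) := hU.preimage continuous_fst
  have hpJ : p ∈ jetBundle U (Fin m → ℝ) n := hp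
  have hA : DifferentiableAt ℝ A.anchor p.1 :=
    (A.anchor_smooth.contDiffAt (hU.mem_nhds hp)).differentiableAt (by simp)
  have hAp : DifferentiableAt ℝ (fun z : JetSpace E (Fin m → ℝ) n => A.anchor z.1) p :=
    hA.comp p differentiableAt_fst
  have diff : ∀ {s : E → Fin m → ℝ} {σ : JetSpace E (Fin m → ℝ) n → Fin (n + 1) → Fin m → ℝ},
      IsProjectable U s σ → DifferentiableAt ℝ σ p := fun h =>
    (h.smooth.contDiffAt (hJ.mem_nhds hpJ)).differentiableAt (by simp)
  -- Projectability enters here: the `Y₁` component is a function of the base point, so its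
  -- derivative is that of the section of `A`.
  have zero : ∀ {s : E → Fin m → ℝ} {σ : JetSpace E (Fin m → ℝ) n → Fin (n + 1) → Fin m → ℝ}
      (_ : IsProjectable U s σ) (w : JetSpace E (Fin m → ℝ) n),
      fderiv ℝ σ p w 0 = fderiv ℝ s p.1 w.1 := by
    intro s σ h w
    have hs : DifferentiableAt ℝ s p.1 :=
      (h.smooth_base.contDiffAt (hU.mem_nhds hp)).differentiableAt (by simp)
    have h1 : (fun z => σ z 0) =ᶠ[nhds p] fun z => s z.1 :=
      Filter.eventuallyEq_of_mem (hJ.mem_nhds hpJ) h.proj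
    have h2 : HasFDerivAt (fun z : JetSpace E (Fin m → ℝ) n => s z.1)
        ((fderiv ℝ s p.1).comp (ContinuousLinearMap.fst ℝ _ _)) p :=
      hs.hasFDerivAt.comp p hasFDerivAt_fst
    have h3 := h1.fderiv_eq.trans h2.fderiv
    rw [fderiv_apply (diff h)] at h3
    exact congrArg (fun l => l w) h3
  -- Along the `y` coordinates the anchored field is merely `σ` with shifted index, so no derivative
  -- of the anchor of `A` appears.
  have succ : ∀ {s : E → Fin m → ℝ} {σ : JetSpace E (Fin m → ℝ) n → Fin (n + 1) → Fin m → ℝ}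
      (_ : IsProjectable U s σ) (w : JetSpace E (Fin m → ℝ) n) (i : Fin n),
      (fderiv ℝ (fun z => prolAnchor A z (σ z)) p w).2 i = fderiv ℝ σ p w i.succ := by
    intro s σ h w i
    have h1 : DifferentiableAt ℝ (fun z => A.anchor z.1 (σ z 0)) p :=
      hAp.clm_apply (differentiableAt_pi.1 (diff h) 0)
    have h2 : HasFDerivAt (fun z (i : Fin n) => σ z i.succ)
        (ContinuousLinearMap.pi fun i : Fin n =>
          (ContinuousLinearMap.proj i.succ).comp (fderiv ℝ σ p)) p :=
      hasFDerivAt_pi.2 fun i => hasFDerivAt_pi'.1 (diff h).hasFDerivAt i.succ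
    have h3 := h1.hasFDerivAt.prodMk h2
    have h4 : HasFDerivAt (fun z => prolAnchor A z (σ z)) _ p := h3
    rw [h4.fderiv]
    rfl
  ext1 j
  refine Fin.cases ?_ (fun i => ?_) j
  · simp only [prolBracket, Fin.cons_zero, Pi.add_apply, Pi.sub_apply, Pi.single_eq_same,
      zero hσ, zero hσ']
    rw [A.bracket_eq hU hσ.smooth_base hσ'.smooth_base hp, hσ.proj p hpJ, hσ'.proj p hpJ]
    simp [prolAnchor, hσ.proj p hpJ, hσ'.proj p hpJ]
  · simp only [prolBracket, Fin.cons_succ, Pi.add_apply, Pi.sub_apply, VectorField.lieBracket,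
      Prod.snd_sub, succ hσ, succ hσ']
    simp

end Frame

/-! ### Covectors that restrict to `dL` on the holonomic vectors. -/

section Tulczyjew

variable {E V : Type*} [NormedAddCommGroup E] [NormedSpace ℝ E]
  [NormedAddCommGroup V] [NormedSpace ℝ V] {n : ℕ}

/-- The map `holonomic` as a continuous linear map. -/
def holonomicCLM (E V : Type*) [NormedAddCommGroup E] [NormedSpace ℝ E]
    [NormedAddCommGroup V] [NormedSpace ℝ V] (n : ℕ) : JetSpace E V (n + 1) →L[ℝ] DSpace E V n where
  toFun := holonomic
  map_add' w w' := by
    refine Prod.ext (Prod.ext rfl rfl) (funext fun j => ?_)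
    simp [holonomic]
  map_smul' c w := by
    refine Prod.ext (Prod.ext rfl rfl) (funext fun j => ?_)
    simp [holonomic, smul_comm c]
  cont := by
    unfold holonomic
    fun_prop

theorem fderiv_holonomic (q w : JetSpace E V (n + 1)) :
    fderiv ℝ (holonomic (E := E) (V := V) (n := n)) q w = holonomic w := by
  change fderiv ℝ (holonomicCLM E V n) q w = _
  rw [ContinuousLinearMap.fderiv]
  rfl

/-- The embedding of `A^{k-1}` in `A^k` as `y_k = 0`, in coordinates. -/
def snocZero (E V : Type*) [NormedAddCommGroup E] [NormedSpace ℝ E]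
    [NormedAddCommGroup V] [NormedSpace ℝ V] (n : ℕ) : JetSpace E V n →L[ℝ] JetSpace E V (n + 1) :=
  (ContinuousLinearMap.fst ℝ _ _).prod
    (ContinuousLinearMap.pi fun j : Fin (n + 1) =>
      Fin.lastCases (motive := fun _ => JetSpace E V n →L[ℝ] V) 0
        (fun w => (ContinuousLinearMap.proj w).comp (ContinuousLinearMap.snd ℝ _ _)) j)

@[simp] theorem snocZero_fst (p : JetSpace E V n) : (snocZero E V n p).1 = p.1 := rfl

@[simp] theorem snocZero_last (p : JetSpace E V n) :
    (snocZero E V n p).2 (Fin.last n) = 0 := by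
  simp [snocZero]

@[simp] theorem snocZero_castSucc (p : JetSpace E V n) (w : Fin n) :
    (snocZero E V n p).2 w.castSucc = p.2 w := by
  simp [snocZero]

theorem holonomic_snocZero_fst (p : JetSpace E V n) : (holonomic (snocZero E V n p)).1 = p := by
  simp [holonomic]

/-- The splitting into a lift from `A^{k-1}` and the `y_k` direction, which is the kernel of the
projection `A^k → A^{k-1}`. -/
theorem eq_snocZero_add (w : JetSpace E V (n + 1)) :
    w = snocZero E V n (w.1, fun i => w.2 i.castSucc) +
      ((0 : E), Pi.single (Fin.last n) (w.2 (Fin.last n))) := by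
  refine Prod.ext (by simp) (funext fun j => ?_)
  refine Fin.lastCases ?_ (fun i => ?_) j <;> simp

theorem holonomic_add (w w' : JetSpace E V (n + 1)) :
    holonomic (w + w') = holonomic w + holonomic w' := map_add (holonomicCLM E V n) w w'

omit [NormedSpace ℝ E] in
theorem holonomic_single (j : Fin (n + 1)) (y : V) :
    (holonomic ((0 : E), Pi.single j y) : DSpace E V n).2 = (((j : ℕ) : ℝ) + 1) • Pi.single j y := by
  ext1 i
  rcases eq_or_ne i j with rfl | h
  · simp [holonomic]
  · simp [holonomic, h]

-- The `y_k` direction becomes vertical in `D(A^k)`, scaled by its weight `k = n + 1`. This is the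
-- source of the equation `k π^1 = ∂L/∂y_k`.
omit [NormedSpace ℝ E] in
theorem holonomic_single_last (y : V) :
    (holonomic ((0 : E), Pi.single (Fin.last n) y) : DSpace E V n) =
      (0, ((n : ℝ) + 1) • Pi.single (Fin.last n) y) := by
  refine Prod.ext (Prod.ext rfl (funext fun w => ?_)) ?_
  · simp [holonomic]
  · rw [holonomic_single]
    simp

/-- The covector at `ι(q)` that restricts to `dL` on the holonomic vectors and to `π` on the
fibre, provided that `L` and `π` are compatible. -/
noncomputable def vakonomicCovector (L : JetSpace E V (n + 1) → ℝ) (q : JetSpace E V (n + 1))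
    (π : (Fin (n + 1) → V) →L[ℝ] ℝ) : DSpace E V n →L[ℝ] ℝ :=
  ((fderiv ℝ L q).comp (snocZero E V n) -
      (π.comp (ContinuousLinearMap.snd ℝ _ _)).comp
        ((holonomicCLM E V n).comp (snocZero E V n))).comp (ContinuousLinearMap.fst ℝ _ _) +
    π.comp (ContinuousLinearMap.snd ℝ _ _)

theorem vakonomicCovector_apply (L : JetSpace E V (n + 1) → ℝ) (q : JetSpace E V (n + 1))
    (π : (Fin (n + 1) → V) →L[ℝ] ℝ) (w : DSpace E V n) :
    vakonomicCovector L q π w = fderiv ℝ L q (snocZero E V n w.1) -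
      π (holonomic (snocZero E V n w.1)).2 + π w.2 := rfl

/-- The lift by `y_k = 0` of a vector of `A^{k-1}` becomes holonomic and differs from its horizontal
copy by a fibre vector. So `dL` and `π` fix `α` on horizontal vectors, and the `y_k` direction
leaves one compatibility condition. -/
theorem isVakonomic_iff {L : JetSpace E V (n + 1) → ℝ} {q : JetSpace E V (n + 1)}
    {d : DSpace E V n} {π : (Fin (n + 1) → V) →L[ℝ] ℝ} {α : DSpace E V n →L[ℝ] ℝ} :
    (IsVakonomic L q d α ∧ ∀ w, π w = α (0, w)) ↔
      d = holonomic q ∧ (∀ y : V, ((n : ℝ) + 1) * π (Pi.single (Fin.last n) y) =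
        fderiv ℝ L q ((0 : E), Pi.single (Fin.last n) y)) ∧ α = vakonomicCovector L q π := by
  have split : ∀ (α : DSpace E V n →L[ℝ] ℝ) (w : DSpace E V n),
      α w = α (w.1, 0) + α (0, w.2) := by
    intro α w
    rw [← map_add]
    simp
  constructor
  · rintro ⟨⟨hd, hα⟩, hπ⟩
    refine ⟨hd, fun y => ?_, ?_⟩
    · rw [← hα, fderiv_holonomic, holonomic_single_last, ← hπ, map_smul, smul_eq_mul]
    · refine ContinuousLinearMap.ext fun w => ?_
      rw [vakonomicCovector_apply, ← hα, fderiv_holonomic, split α w, split α (holonomic _),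
        hπ, hπ, holonomic_snocZero_fst]
      ring
  · rintro ⟨hd, hL, rfl⟩
    refine ⟨⟨hd, fun w => ?_⟩, fun w => ?_⟩
    · rw [fderiv_holonomic, vakonomicCovector_apply]
      conv_rhs => rw [eq_snocZero_add w, map_add, ← hL]
      have h : holonomic w = holonomic (snocZero E V n (holonomic w).1) +
          ((0 : JetSpace E V n),
            ((n : ℝ) + 1) • (Pi.single (Fin.last n) (w.2 (Fin.last n)) : Fin (n + 1) → V)) := by
        conv_lhs => rw [eq_snocZero_add w, holonomic_add, holonomic_single_last]
        rfl
      have h2 : (holonomic w).2 = (holonomic (snocZero E V n (holonomic w).1)).2 +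
          ((n : ℝ) + 1) • (Pi.single (Fin.last n) (w.2 (Fin.last n)) : Fin (n + 1) → V) := congrArg Prod.snd h
      rw [h2, map_add, map_smul, smul_eq_mul]
      have h3 : (holonomic w).1 = (w.1, fun i => w.2 i.castSucc) := rfl
      rw [h3]
      ring
    · have h : holonomic (0 : JetSpace E V (n + 1)) = 0 := map_zero (holonomicCLM E V n)
      simp [vakonomicCovector_apply, h]

end Tulczyjew

/-! ### The algebroid morphism and the Tulczyjew differential in coordinates. -/

section Coordinates

variable {d m n : ℕ}

/-- Testing on constant sections gives one direction. For the other, the derivative of `σ'` occurs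
equally on both sides because `v` covers the anchor, and the derivative of `σ` in the bracket
cancels the one under `α`, since `α` agrees with `b` on the fibre. -/
theorem isEpsilon_iff {E : Type*} [NormedAddCommGroup E] [NormedSpace ℝ E] {U : Set E}
    (A : LieAlgebroid U (Fin m → ℝ)) (hU : IsOpen U)
    {δ : DSpace E (Fin m → ℝ) n} (hδ : δ.1.1 ∈ U) {α : DSpace E (Fin m → ℝ) n →L[ℝ] ℝ}
    {b v : DDualSpace E (Fin m → ℝ) n} :
    IsEpsilon A δ α b v ↔ b.1 = δ.1 ∧ (∀ w, b.2 w = α (0, w)) ∧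
      v.1 = prolAnchor A δ.1 δ.2 ∧
      ∀ Y : Fin (n + 1) → Fin m → ℝ, v.2 Y =
        b.2 (Pi.single 0 (A.constBracket hδ (δ.2 0) (Y 0))) + α (prolAnchor A δ.1 Y, 0) := by
  have split : ∀ (α : DSpace E (Fin m → ℝ) n →L[ℝ] ℝ) (x : JetSpace E (Fin m → ℝ) n)
      (y : Fin (n + 1) → Fin m → ℝ), α (x, y) = α (x, 0) + α (0, y) := by
    intro α x y
    rw [← map_add]
    simp
  constructor
  · rintro ⟨h1, h2, h3, h4⟩
    refine ⟨h1, h2, h3, fun Y => ?_⟩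
    have hc : ∀ Y : Fin (n + 1) → Fin m → ℝ,
        IsProjectable U (fun _ => Y 0) (fun _ : JetSpace E (Fin m → ℝ) n => Y) := fun Y =>
      ⟨contDiffOn_const, contDiffOn_const, fun _ _ => rfl⟩
    have h := h4 _ _ _ _ (hc δ.2) (hc Y) rfl
    rw [prolBracket_eq A hU (hc δ.2) (hc Y) hδ] at h
    simpa using h
  · rintro ⟨h1, h2, h3, h4⟩
    refine ⟨h1, h2, h3, fun s s' σ σ' hσ hσ' hd => ?_⟩
    rw [prolBracket_eq A hU hσ hσ' hδ, h4, h3, hd, split α _ (fderiv ℝ σ _ _), ← h2, map_sub,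
      map_add]
    ring

/-- `constBracket` is bundled as linear in its second argument only, so skew symmetry is applied
before and after expanding `u`. -/
theorem LieAlgebroid.constBracket_single {U : Set (Fin d → ℝ)} (A : LieAlgebroid U (Fin m → ℝ))
    {x : Fin d → ℝ} (hx : x ∈ U) (u : Fin m → ℝ) (a c : Fin m) :
    A.constBracket hx u (Pi.single a 1) c = ∑ b, u b * structureCoeff A x b a c := by
  have h : u = ∑ b, u b • (Pi.single b (1 : ℝ) : Fin m → ℝ) := by
    ext c
    simp [Finset.sum_apply, Pi.single_apply]
  rw [A.constBracket_skew hx]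
  conv_lhs => rw [h, map_sum]
  simp only [map_smul, Pi.neg_apply, Finset.sum_apply, Pi.smul_apply, smul_eq_mul,
    ← Finset.sum_neg_distrib]
  refine Finset.sum_congr rfl fun b _ => ?_
  rw [← mul_neg, ← Pi.neg_apply, ← A.constBracket_skew hx]
  rfl

theorem map_eq_sum_single (l : (Fin m → ℝ) →L[ℝ] ℝ) (u : Fin m → ℝ) :
    l u = ∑ c, u c * l (Pi.single c 1) := by
  have h : u = ∑ b, u b • (Pi.single b (1 : ℝ) : Fin m → ℝ) := by
    ext c
    simp [Finset.sum_apply, Pi.single_apply]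
  conv_lhs => rw [h, map_sum]
  simp

theorem anchor_eq_sum {U : Set (Fin d → ℝ)} (A : LieAlgebroid U (Fin m → ℝ)) (x : Fin d → ℝ)
    (u : Fin m → ℝ) (i : Fin d) : A.anchor x u i = ∑ a, rhoCoeff A x a i * u a := by
  have := map_eq_sum_single ((ContinuousLinearMap.proj i).comp (A.anchor x)) u
  simpa [rhoCoeff, mul_comm] using this

theorem momentum_ext {ξ η : (Fin (n + 1) → Fin m → ℝ) →L[ℝ] ℝ} :
    ξ = η ↔ ∀ j a, momentum ξ j a = momentum η j a := by
  refine ⟨fun h j a => by rw [h], fun h => ?_⟩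
  apply ContinuousLinearMap.coe_injective
  refine LinearMap.pi_ext' fun j => ?_
  refine LinearMap.pi_ext' fun a => ?_
  ext
  exact h j a

/-- The weighted Tulczyjew differential in coordinates. -/
theorem isTulczyjewRelated_iff {U : Set (Fin d → ℝ)} (A : LieAlgebroid U (Fin m → ℝ))
    (hU : IsOpen U) (L : JetSpace (Fin d → ℝ) (Fin m → ℝ) (n + 1) → ℝ)
    {q : JetSpace (Fin d → ℝ) (Fin m → ℝ) (n + 1)} (hq : q ∈ jetBundle U (Fin m → ℝ) (n + 1))
    (b v : DDualSpace (Fin d → ℝ) (Fin m → ℝ) n) :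
    IsTulczyjewRelated A L q b v ↔
      b.1 = (q.1, fun w => q.2 w.castSucc) ∧
      (∀ i, v.1.1 i = ∑ a, rhoCoeff A q.1 a i * q.2 0 a) ∧
      (∀ (w : Fin n) (a : Fin m), v.1.2 w a = ((w : ℕ) + 2) * q.2 w.succ a) ∧
      (∀ a, ((n : ℝ) + 1) * momentum b.2 (Fin.last n) a = dLdy L q (Fin.last n) a) ∧
      (∀ (w : Fin n) (a : Fin m), momentum v.2 w.succ a =
        dLdy L q w.castSucc a - ((w : ℕ) + 1) * momentum b.2 w.castSucc a) ∧
      (∀ a, momentum v.2 0 a = ∑ i, rhoCoeff A q.1 a i * dLdx L q i +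
        ∑ b', ∑ c, q.2 0 b' * structureCoeff A q.1 b' a c * momentum b.2 0 c) := by
  have hq' : (holonomic q).1.1 ∈ U := hq
  -- Both existential witnesses are forced: the point is `ι(q)` and the covector is
  -- `vakonomicCovector`.
  have step : IsTulczyjewRelated A L q b v ↔
      b.1 = (holonomic q).1 ∧ v.1 = prolAnchor A (holonomic q).1 (holonomic q).2 ∧
      (∀ y : Fin m → ℝ, ((n : ℝ) + 1) * b.2 (Pi.single (Fin.last n) y) =
        fderiv ℝ L q (0, Pi.single (Fin.last n) y)) ∧
      ∀ Y : Fin (n + 1) → Fin m → ℝ, v.2 Y =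
        b.2 (Pi.single 0 (A.constBracket hq' ((holonomic q).2 0) (Y 0))) +
          vakonomicCovector L q b.2 (prolAnchor A (holonomic q).1 Y, 0) := by
    constructor
    · rintro ⟨-, δ, α, hL, hε⟩
      obtain rfl : δ = holonomic q := hL.1
      obtain ⟨h1, h2, h3, h4⟩ := (isEpsilon_iff A hU hq').1 hε
      obtain ⟨-, h5, rfl⟩ := isVakonomic_iff.1 ⟨hL, h2⟩
      exact ⟨h1, h3, h5, h4⟩
    · rintro ⟨h1, h3, h5, h4⟩
      obtain ⟨hL, h2⟩ := isVakonomic_iff.2 ⟨rfl, h5, rfl⟩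
      exact ⟨hq, _, _, hL, (isEpsilon_iff A hU hq').2 ⟨h1, h2, h3, h4⟩⟩
  rw [step]
  have anchor_iff : v.1 = prolAnchor A (holonomic q).1 (holonomic q).2 ↔
      (∀ i, v.1.1 i = ∑ a, rhoCoeff A q.1 a i * q.2 0 a) ∧
      (∀ (w : Fin n) (a : Fin m), v.1.2 w a = ((w : ℕ) + 2) * q.2 w.succ a) := by
    rw [Prod.ext_iff, funext_iff, funext_iff]
    refine and_congr (forall_congr' fun i => ?_) (forall_congr' fun w => ?_)
    · rw [← anchor_eq_sum]
      simp [prolAnchor, holonomic]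
    · rw [funext_iff]
      refine forall_congr' fun a => ?_
      simp only [prolAnchor, holonomic, ContinuousLinearMap.prod_apply,
        ContinuousLinearMap.coe_pi', ContinuousLinearMap.proj_apply, Fin.val_succ, Pi.smul_apply,
        smul_eq_mul]
      push_cast
      rw [add_assoc, one_add_one_eq_two]
  have last_iff : (∀ y : Fin m → ℝ, ((n : ℝ) + 1) * b.2 (Pi.single (Fin.last n) y) =
        fderiv ℝ L q (0, Pi.single (Fin.last n) y)) ↔
      ∀ a, ((n : ℝ) + 1) * momentum b.2 (Fin.last n) a = dLdy L q (Fin.last n) a := by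
    refine ⟨fun h a => h _, fun h y => ?_⟩
    have h1 := map_eq_sum_single
      (b.2.comp (ContinuousLinearMap.single ℝ (fun _ : Fin (n + 1) => Fin m → ℝ) (Fin.last n))) y
    have h2 := map_eq_sum_single ((fderiv ℝ L q).comp
      ((ContinuousLinearMap.inr ℝ _ _).comp
        (ContinuousLinearMap.single ℝ (fun _ : Fin (n + 1) => Fin m → ℝ) (Fin.last n)))) y
    refine (congrArg (((n : ℝ) + 1) * ·) h1).trans (Eq.trans ?_ h2.symm)
    simp only [Finset.mul_sum]
    refine Finset.sum_congr rfl fun a _ => ?_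
    have h3 := h a
    simp only [momentum, dLdy] at h3
    simp only [ContinuousLinearMap.comp_apply, ContinuousLinearMap.single_apply,
      ContinuousLinearMap.inr_apply]
    rw [← h3]
    ring
  have bracket_iff : (∀ Y : Fin (n + 1) → Fin m → ℝ, v.2 Y =
        b.2 (Pi.single 0 (A.constBracket hq' ((holonomic q).2 0) (Y 0))) +
          vakonomicCovector L q b.2 (prolAnchor A (holonomic q).1 Y, 0)) ↔
      ∀ j a, momentum v.2 j a =
        b.2 (Pi.single 0 (A.constBracket hq' ((holonomic q).2 0)
          ((Pi.single j (Pi.single a 1) : Fin (n + 1) → Fin m → ℝ) 0))) +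
          vakonomicCovector L q b.2 (prolAnchor A (holonomic q).1
            (Pi.single j (Pi.single a 1)), 0) := by
    refine ⟨fun h j a => h _, fun h => ?_⟩
    -- The right-hand side as one continuous linear functional of `Y`, so that `momentum_ext`
    -- reduces equality to frame vectors.
    let l : (Fin (n + 1) → Fin m → ℝ) →L[ℝ] ℝ :=
      ((b.2.comp (ContinuousLinearMap.single ℝ (fun _ : Fin (n + 1) => Fin m → ℝ) 0)).comp
        (A.constBracket hq' ((holonomic q).2 0)).toContinuousLinearMap).comp
        (ContinuousLinearMap.proj 0) +
      (vakonomicCovector L q b.2).comp ((ContinuousLinearMap.inl ℝ _ _).comp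
        (prolAnchor A (holonomic q).1))
    have hl : v.2 = l := momentum_ext.2 h
    intro Y
    rw [hl]
    rfl
  have split : (∀ j a, momentum v.2 j a =
        b.2 (Pi.single 0 (A.constBracket hq' ((holonomic q).2 0)
          ((Pi.single j (Pi.single a 1) : Fin (n + 1) → Fin m → ℝ) 0))) +
          vakonomicCovector L q b.2 (prolAnchor A (holonomic q).1
            (Pi.single j (Pi.single a 1)), 0)) ↔
      (∀ (w : Fin n) (a : Fin m), momentum v.2 w.succ a =
        dLdy L q w.castSucc a - ((w : ℕ) + 1) * momentum b.2 w.castSucc a) ∧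
      (∀ a, momentum v.2 0 a = ∑ i, rhoCoeff A q.1 a i * dLdx L q i +
        ∑ b', ∑ c, q.2 0 b' * structureCoeff A q.1 b' a c * momentum b.2 0 c) := by
    rw [Fin.forall_fin_succ, and_comm]
    refine and_congr (forall_congr' fun w => forall_congr' fun a => ?_)
      (forall_congr' fun a => ?_)
    -- Slot `w.succ`, that is `Y_{w+2}`: the bracket term vanishes and the anchor gives the
    -- direction of the coordinate with index `w`, which has weight `w + 1`.
    · have h1 : snocZero (Fin d → ℝ) (Fin m → ℝ) n (prolAnchor A (holonomic q).1
          (Pi.single w.succ (Pi.single a 1))) = (0, Pi.single w.castSucc (Pi.single a 1)) := by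
        refine Prod.ext ?_ (funext fun j => ?_)
        · simp [prolAnchor]
        · refine Fin.lastCases ?_ (fun i => ?_) j
          · rw [snocZero_last]
            exact (Pi.single_eq_of_ne (M := fun _ : Fin (n + 1) => Fin m → ℝ)
              (Fin.castSucc_lt_last w).ne' _).symm
          · rcases eq_or_ne i w with rfl | h
            · simp [prolAnchor]
            · simp [prolAnchor, h]
      rw [vakonomicCovector_apply, h1, holonomic_single]
      simp [momentum, dLdy]
    -- Slot `0`: the anchor gives a vector along `x` only, whose holonomic image has no fibre part.
    -- Here the bracket term survives.
    · have h1 : snocZero (Fin d → ℝ) (Fin m → ℝ) n (prolAnchor A (holonomic q).1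
          (Pi.single 0 (Pi.single a 1))) = (A.anchor q.1 (Pi.single a 1), 0) := by
        refine Prod.ext ?_ (funext fun j => ?_)
        · simp [prolAnchor, holonomic]
        · refine Fin.lastCases ?_ (fun i => ?_) j
          · simp
          · simp [prolAnchor]
      have h2 : (holonomic ((A.anchor q.1 (Pi.single a 1), 0) :
          JetSpace (Fin d → ℝ) (Fin m → ℝ) (n + 1))).2 = 0 := by
        ext; simp [holonomic]
      have h3 : fderiv ℝ L q (A.anchor q.1 (Pi.single a 1), 0) =
          ∑ i, rhoCoeff A q.1 a i * dLdx L q i :=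
        map_eq_sum_single ((fderiv ℝ L q).comp (ContinuousLinearMap.inl ℝ _ _)) _
      have h4 := map_eq_sum_single (b.2.comp
        (ContinuousLinearMap.single ℝ (fun _ : Fin (n + 1) => Fin m → ℝ) 0))
        (A.constBracket hq' (q.2 0) (Pi.single a 1))
      have h5 : (holonomic q).2 0 = q.2 0 := by simp [holonomic]
      have h6 : b.2 (Pi.single 0 (A.constBracket hq' (q.2 0) (Pi.single a 1))) =
          ∑ b', ∑ c, q.2 0 b' * structureCoeff A q.1 b' a c * momentum b.2 0 c := by
        refine h4.trans ?_
        rw [Finset.sum_comm]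
        refine Finset.sum_congr rfl fun c _ => ?_
        rw [A.constBracket_single hq', Finset.sum_mul]
        rfl
      rw [vakonomicCovector_apply, h1, h2, h3, Pi.single_eq_same, h5, h6, map_zero,
        sub_zero, add_zero]
      exact iff_of_eq (congrArg _ (add_comm _ _))
  rw [anchor_iff, last_iff, bracket_iff, split]
  simp only [and_assoc]
  rfl

end Coordinates

/-! ### Differentiation along curves over an open set of times. -/

section Curves

variable {F : Type*} [NormedAddCommGroup F] [NormedSpace ℝ F] {J : Set ℝ}

theorem contDiffOn_iteratedDeriv (hJ : IsOpen J) {f : ℝ → F} (hf : ContDiffOn ℝ ∞ f J) (k : ℕ) :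
    ContDiffOn ℝ ∞ (iteratedDeriv k f) J := by
  induction k with
  | zero => simpa using hf
  | succ k ih =>
    rw [iteratedDeriv_succ]
    exact ih.deriv_of_isOpen hJ (by simp)

theorem differentiableAt_of_contDiffOn (hJ : IsOpen J) {f : ℝ → F} (hf : ContDiffOn ℝ ∞ f J)
    {t : ℝ} (ht : t ∈ J) : DifferentiableAt ℝ f t :=
  (hf.contDiffAt (hJ.mem_nhds ht)).differentiableAt (by simp)

theorem deriv_eq_of_eqOn (hJ : IsOpen J) {f g : ℝ → F} (h : EqOn f g J) {t : ℝ} (ht : t ∈ J) :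
    deriv f t = deriv g t :=
  (Filter.eventuallyEq_of_mem (hJ.mem_nhds ht) h).deriv_eq

theorem deriv_clm_comp {G : Type*} [NormedAddCommGroup G] [NormedSpace ℝ G] (l : F →L[ℝ] G)
    {f : ℝ → F} {t : ℝ} (hf : DifferentiableAt ℝ f t) :
    deriv (fun s => l (f s)) t = l (deriv f t) :=
  (l.hasFDerivAt.comp_hasDerivAt t hf.hasDerivAt).deriv

end Curves

/-! ### Jets characterised by first-order equations. -/

section Holonomic

variable {E V : Type*} [NormedAddCommGroup E] [NormedSpace ℝ E]
  [NormedAddCommGroup V] [NormedSpace ℝ V] {n : ℕ} {J : Set ℝ}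

/-- A curve whose lower part is differentiable consists of jets of its component `y₁` if and only
if `y_w' = (w + 1) y_{w+1}`. -/
theorem deriv_eq_iff_eq_iteratedDeriv (hJ : IsOpen J) {y : ℝ → Fin (n + 1) → V} :
    (∀ t ∈ J, ∀ w : Fin n, deriv (fun s => y s w.castSucc) t = ((w : ℝ) + 2) • y t w.succ) ↔
      ∀ t ∈ J, ∀ j : Fin (n + 1),
        y t j = (1 / (((j : ℕ) + 1).factorial : ℝ)) • iteratedDeriv j (fun s => y s 0) t := by
  -- The normalisation `1/j!` turns one differentiation into multiplication by the next weight, here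
  -- `w + 2`.
  have fac : ∀ w : Fin n, (1 / (((w : ℕ) + 1).factorial : ℝ)) =
      ((w : ℝ) + 2) * (1 / (((w.succ : ℕ) + 1).factorial : ℝ)) := by
    intro w
    rw [Fin.val_succ, Nat.factorial_succ ((w : ℕ) + 1)]
    have : (((w : ℕ) + 1).factorial : ℝ) ≠ 0 := by positivity
    push_cast
    have h2 : ((w : ℝ) + 1 + 1) ≠ 0 := by positivity
    field_simp
    ring
  have step : ∀ w : Fin n,
      (∀ t ∈ J, y t w.castSucc = (1 / (((w.castSucc : ℕ) + 1).factorial : ℝ)) •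
        iteratedDeriv w.castSucc (fun s => y s 0) t) →
      ∀ t ∈ J, deriv (fun s => y s w.castSucc) t = ((w : ℝ) + 2) •
        (1 / (((w.succ : ℕ) + 1).factorial : ℝ)) • iteratedDeriv w.succ (fun s => y s 0) t := by
    intro w h t ht
    rw [deriv_eq_of_eqOn hJ h ht, deriv_fun_const_smul_field, ← iteratedDeriv_succ,
      Fin.val_castSucc, fac, mul_smul]
    rfl
  constructor
  · intro h
    have main : ∀ j : Fin (n + 1), ∀ t ∈ J,
        y t j = (1 / (((j : ℕ) + 1).factorial : ℝ)) • iteratedDeriv j (fun s => y s 0) t := by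
      intro j
      induction j using Fin.induction with
      | zero => simp
      | succ w ih =>
        intro t ht
        have h1 := (h t ht w).symm.trans (step w ih t ht)
        have h2 : ((w : ℝ) + 2) ≠ 0 := by positivity
        exact smul_right_injective _ h2 h1
    exact fun t ht j => main j t ht
  · intro h t ht w
    rw [step w (fun t ht => h t ht _) t ht, ← h t ht]

end Holonomic

/-! ### Jacobi–Ostrogradski momenta and the Euler–Lagrange equations. -/

section Coordinates

variable {d m n : ℕ} {J : Set ℝ} {U : Set (Fin d → ℝ)}

theorem contDiffOn_dLdy (hU : IsOpen U)
    {L : JetSpace (Fin d → ℝ) (Fin m → ℝ) n → ℝ}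
    (hL : ContDiffOn ℝ ∞ L (jetBundle U (Fin m → ℝ) n))
    {γ : ℝ → JetSpace (Fin d → ℝ) (Fin m → ℝ) n} (hγ : ContDiffOn ℝ ∞ γ J)
    (hm : ∀ t ∈ J, γ t ∈ jetBundle U (Fin m → ℝ) n) (j : Fin n) (a : Fin m) :
    ContDiffOn ℝ ∞ (fun t => dLdy L (γ t) j a) J := by
  have hB : IsOpen (jetBundle U (Fin m → ℝ) n) := hU.preimage continuous_fst
  have h := (hL.fderiv_of_isOpen (m := ∞) hB (by simp)).comp hγ hm
  exact h.clm_apply contDiffOn_const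

theorem mul_jacobiOstrogradski_last (L : JetSpace (Fin d → ℝ) (Fin m → ℝ) (n + 1) → ℝ)
    (γ : ℝ → JetSpace (Fin d → ℝ) (Fin m → ℝ) (n + 1)) (a : Fin m) (t : ℝ) :
    ((n : ℝ) + 1) * jacobiOstrogradski L γ (Fin.last n) a t = dLdy L (γ t) (Fin.last n) a := by
  have h : Finset.Ici (Fin.last n) = {Fin.last n} := by
    ext j
    simp [Fin.last_le_iff]
  have h1 : ((n.factorial : ℕ) : ℝ) ≠ 0 := by positivity
  have h2 : ((n : ℝ) + 1) ≠ 0 := by positivity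
  rw [jacobiOstrogradski, h, Finset.sum_singleton]
  simp only [Fin.val_last, Nat.sub_self, pow_zero, iteratedDeriv_zero, Nat.factorial_succ]
  push_cast
  field_simp

/-- The Jacobi–Ostrogradski expressions satisfy the recursion of the momenta. -/
theorem mul_jacobiOstrogradski_castSucc (hJ : IsOpen J)
    {L : JetSpace (Fin d → ℝ) (Fin m → ℝ) (n + 1) → ℝ}
    {γ : ℝ → JetSpace (Fin d → ℝ) (Fin m → ℝ) (n + 1)} {a : Fin m}
    (h : ∀ j, ContDiffOn ℝ ∞ (fun t => dLdy L (γ t) j a) J) (w : Fin n) {t : ℝ} (ht : t ∈ J) :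
    ((w : ℝ) + 1) * jacobiOstrogradski L γ w.castSucc a t =
      dLdy L (γ t) w.castSucc a - deriv (jacobiOstrogradski L γ w.succ a) t := by
  -- Split off the term of lowest index, which has no time derivative and gives `∂L/∂y_{w+1}`. Each
  -- remaining term carries one more derivative and the opposite sign than in the sum for `w.succ`,
  -- and `(w + 1) w! = (w + 1)!`.
  have h1 : Finset.Ici w.castSucc = insert w.castSucc (Finset.Ici w.succ) := by
    ext j
    simp only [Finset.mem_Ici, Finset.mem_insert, Fin.le_def, Fin.ext_iff, Fin.val_castSucc,
      Fin.val_succ]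
    omega
  have h2 : w.castSucc ∉ Finset.Ici w.succ := by
    simp [Fin.le_def]
  have h3 : ∀ j k, DifferentiableAt ℝ (iteratedDeriv k fun τ => dLdy L (γ τ) j a) t := fun j k =>
    differentiableAt_of_contDiffOn hJ (contDiffOn_iteratedDeriv hJ (h j) k) ht
  have h4 : deriv (jacobiOstrogradski L γ w.succ a) t =
      ∑ j ∈ Finset.Ici w.succ, (-1 : ℝ) ^ ((j : ℕ) - (w.succ : ℕ)) *
        (((w.succ : ℕ).factorial : ℝ) / (((j : ℕ) + 1).factorial : ℝ)) *
        iteratedDeriv ((j : ℕ) - (w.succ : ℕ) + 1) (fun τ => dLdy L (γ τ) j a) t := by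
    unfold jacobiOstrogradski
    rw [deriv_fun_sum fun j _ => (h3 _ _).const_mul _]
    refine Finset.sum_congr rfl fun j _ => ?_
    rw [deriv_const_mul _ (h3 _ _), iteratedDeriv_succ]
  have hf : ((w : ℕ).factorial : ℝ) ≠ 0 := by positivity
  have hw : ((w : ℝ) + 1) ≠ 0 := by positivity
  rw [h4, jacobiOstrogradski, h1, Finset.sum_insert h2, mul_add, sub_eq_add_neg,
    ← Finset.sum_neg_distrib, Finset.mul_sum]
  congr 1
  · simp only [Fin.val_castSucc, Nat.sub_self, pow_zero, iteratedDeriv_zero, Nat.factorial_succ]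
    push_cast
    field_simp
  · refine Finset.sum_congr rfl fun j hj => ?_
    have hj' : (w : ℕ) + 1 ≤ j := by simpa [Fin.le_def] using hj
    have e : (j : ℕ) - (w.castSucc : ℕ) = (j : ℕ) - (w.succ : ℕ) + 1 := by
      simp only [Fin.val_castSucc, Fin.val_succ]
      omega
    rw [e, pow_succ, Fin.val_castSucc, Fin.val_succ, Nat.factorial_succ (w : ℕ)]
    push_cast
    ring

theorem contDiffOn_jacobiOstrogradski (hJ : IsOpen J)
    {L : JetSpace (Fin d → ℝ) (Fin m → ℝ) (n + 1) → ℝ}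
    {γ : ℝ → JetSpace (Fin d → ℝ) (Fin m → ℝ) (n + 1)} {a : Fin m}
    (h : ∀ j, ContDiffOn ℝ ∞ (fun t => dLdy L (γ t) j a) J) (i : Fin (n + 1)) :
    ContDiffOn ℝ ∞ (jacobiOstrogradski L γ i a) J := by
  unfold jacobiOstrogradski
  exact ContDiffOn.sum fun j _ => contDiffOn_const.mul (contDiffOn_iteratedDeriv hJ (h j) _)

theorem jacobiOstrogradski_zero (L : JetSpace (Fin d → ℝ) (Fin m → ℝ) (n + 1) → ℝ)
    (γ : ℝ → JetSpace (Fin d → ℝ) (Fin m → ℝ) (n + 1)) (a : Fin m) :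
    jacobiOstrogradski L γ 0 a = fun t => ∑ j : Fin (n + 1), (-1 : ℝ) ^ (j : ℕ) *
      (1 / (((j : ℕ) + 1).factorial : ℝ)) * iteratedDeriv j (fun τ => dLdy L (γ τ) j a) t := by
  have h : Finset.Ici (0 : Fin (n + 1)) = Finset.univ := by
    ext j
    simp
  funext t
  simp [jacobiOstrogradski, h]

theorem deriv_momentum {β : ℝ → DDualSpace (Fin d → ℝ) (Fin m → ℝ) n} {t : ℝ}
    (hβ : DifferentiableAt ℝ β t) (j : Fin (n + 1)) (a : Fin m) :
    deriv (fun s => momentum (β s).2 j a) t = momentum (deriv β t).2 j a :=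
  deriv_clm_comp ((ContinuousLinearMap.apply ℝ ℝ
    (Pi.single j (Pi.single a 1) : Fin (n + 1) → Fin m → ℝ)).comp
      (ContinuousLinearMap.snd ℝ (JetSpace (Fin d → ℝ) (Fin m → ℝ) n) _)) hβ

/-- The base part of the relation between a curve in `A^k` and the prolongation of a curve in
`D^*(A^k)`. -/
theorem base_relation_iff (A : LieAlgebroid U (Fin m → ℝ)) (hJ : IsOpen J)
    {β : ℝ → DDualSpace (Fin d → ℝ) (Fin m → ℝ) n} (hβ : ContDiffOn ℝ ∞ β J)
    {γ : ℝ → JetSpace (Fin d → ℝ) (Fin m → ℝ) (n + 1)}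
    (hb : ∀ t ∈ J, (β t).1 = ((γ t).1, fun w => (γ t).2 w.castSucc)) :
    (∀ t ∈ J, (∀ i, (deriv β t).1.1 i = ∑ a, rhoCoeff A (γ t).1 a i * (γ t).2 0 a) ∧
      ∀ (w : Fin n) (a : Fin m), (deriv β t).1.2 w a = ((w : ℕ) + 2) * (γ t).2 w.succ a) ↔
    IsAdmissible A J (fun s => ((γ s).1, (γ s).2 0)) ∧
      ∀ t ∈ J, γ t = jet (n + 1) (fun s => ((γ s).1, (γ s).2 0)) t := by
  have hd : ∀ t ∈ J, DifferentiableAt ℝ β t := fun t ht => differentiableAt_of_contDiffOn hJ hβ ht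
  -- No smoothness of `γ` is assumed: its lower components agree on `J` with the base of `β`, so
  -- their derivatives are read off from `β`.
  have e1 : EqOn (fun s => (γ s).1) (fun s => (β s).1.1) J := fun s hs => by simp [hb s hs]
  have e2 : ∀ w : Fin n, EqOn (fun s => (γ s).2 w.castSucc) (fun s => (β s).1.2 w) J :=
    fun w s hs => by simp [hb s hs]
  have d1 : ∀ t ∈ J, HasDerivAt (fun s => (γ s).1) (deriv β t).1.1 t := fun t ht => by
    have h := ((ContinuousLinearMap.fst ℝ (Fin d → ℝ) (Fin n → Fin m → ℝ)).comp
      (ContinuousLinearMap.fst ℝ _ ((Fin (n + 1) → Fin m → ℝ) →L[ℝ] ℝ))).hasFDerivAt.comp_hasDerivAt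
        t (hd t ht).hasDerivAt
    exact h.congr_of_eventuallyEq (Filter.eventuallyEq_of_mem (hJ.mem_nhds ht) e1)
  have d2 : ∀ t ∈ J, ∀ w : Fin n,
      deriv (fun s => (γ s).2 w.castSucc) t = (deriv β t).1.2 w := fun t ht w => by
    rw [deriv_eq_of_eqOn hJ (e2 w) ht]
    exact deriv_clm_comp ((ContinuousLinearMap.proj (φ := fun _ : Fin n => Fin m → ℝ) w).comp
      ((ContinuousLinearMap.snd ℝ (Fin d → ℝ) (Fin n → Fin m → ℝ)).comp
      (ContinuousLinearMap.fst ℝ _ ((Fin (n + 1) → Fin m → ℝ) →L[ℝ] ℝ)))) (hd t ht)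
  have h1 : (∀ t ∈ J, ∀ i, (deriv β t).1.1 i = ∑ a, rhoCoeff A (γ t).1 a i * (γ t).2 0 a) ↔
      IsAdmissible A J (fun s => ((γ s).1, (γ s).2 0)) := by
    refine forall₂_congr fun t ht => ?_
    have h : (∀ i, (deriv β t).1.1 i = ∑ a, rhoCoeff A (γ t).1 a i * (γ t).2 0 a) ↔
        (deriv β t).1.1 = A.anchor (γ t).1 ((γ t).2 0) := by
      rw [funext_iff]
      exact forall_congr' fun i => by rw [anchor_eq_sum]
    rw [h]
    refine ⟨fun h => ?_, fun h => (d1 t ht).unique h⟩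
    have := d1 t ht
    rw [h] at this
    exact this
  have h2 : (∀ t ∈ J, ∀ (w : Fin n) (a : Fin m),
      (deriv β t).1.2 w a = ((w : ℕ) + 2) * (γ t).2 w.succ a) ↔
      ∀ t ∈ J, γ t = jet (n + 1) (fun s => ((γ s).1, (γ s).2 0)) t := by
    have h3 : (∀ t ∈ J, γ t = jet (n + 1) (fun s => ((γ s).1, (γ s).2 0)) t) ↔ _ :=
      (forall₂_congr fun t ht => by
        rw [Prod.ext_iff, funext_iff (f := (γ t).2)]
        simp only [jet, true_and]).trans
        (deriv_eq_iff_eq_iteratedDeriv (y := fun s => (γ s).2) hJ).symm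
    rw [h3]
    refine forall₂_congr fun t ht => forall_congr' fun w => ?_
    rw [d2 t ht, funext_iff]
    rfl
  rw [← h1, ← h2, ← forall₂_and]

/-- For `k ≥ 2` a curve in `A^k` related to the prolongation of a smooth curve is smooth. -/
theorem contDiffOn_of_base_relation (hJ : IsOpen J)
    {β : ℝ → DDualSpace (Fin d → ℝ) (Fin m → ℝ) n} (hβ : ContDiffOn ℝ ∞ β J)
    {γ : ℝ → JetSpace (Fin d → ℝ) (Fin m → ℝ) (n + 1)}
    (hb : ∀ t ∈ J, (β t).1 = ((γ t).1, fun w => (γ t).2 w.castSucc))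
    (hy : ∀ t ∈ J, ∀ (w : Fin n) (a : Fin m),
      (deriv β t).1.2 w a = ((w : ℕ) + 2) * (γ t).2 w.succ a) (hn : 0 < n) :
    ContDiffOn ℝ ∞ γ J := by
  have hx : ContDiffOn ℝ ∞ (fun s => (γ s).1) J :=
    (hβ.fst.fst).congr fun s hs => by simp [hb s hs]
  refine hx.prodMk (contDiffOn_pi.2 fun j => ?_)
  refine Fin.cases ?_ (fun w => ?_) j
  -- `y₁` is a coordinate of the base of `β` because `n > 0`; the higher coordinates come from the
  -- derivative of `β`.
  · refine (contDiffOn_pi.1 hβ.fst.snd (⟨0, hn⟩ : Fin n)).congr fun s hs => ?_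
    rw [hb s hs]
    rfl
  · have h := (hβ.deriv_of_isOpen (m := ∞) hJ (by simp)).fst.snd
    refine ((contDiffOn_pi.1 h w).const_smul (1 / ((w : ℝ) + 2))).congr fun s hs => ?_
    funext a
    have h2 : ((w : ℝ) + 2) ≠ 0 := by positivity
    rw [Pi.smul_apply, hy s hs, smul_eq_mul]
    field_simp

/-- The curves related to the prolongation of a given smooth curve of the phase space. -/
theorem isRelatedToProlongation_iff (A : LieAlgebroid U (Fin m → ℝ)) (hU : IsOpen U)
    {L : JetSpace (Fin d → ℝ) (Fin m → ℝ) (n + 1) → ℝ}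
    (hL : ContDiffOn ℝ ∞ L (jetBundle U (Fin m → ℝ) (n + 1))) (hJ : IsOpen J)
    {β : ℝ → DDualSpace (Fin d → ℝ) (Fin m → ℝ) n} (hβ : ContDiffOn ℝ ∞ β J)
    (γ : ℝ → JetSpace (Fin d → ℝ) (Fin m → ℝ) (n + 1)) :
    IsRelatedToProlongation A L J γ β ↔
      IsAdmissible A J (fun s => ((γ s).1, (γ s).2 0)) ∧
      ∀ t ∈ J, γ t ∈ jetBundle U (Fin m → ℝ) (n + 1) ∧
        (β t).1 = ((γ t).1, fun w => (γ t).2 w.castSucc) ∧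
        γ t = jet (n + 1) (fun s => ((γ s).1, (γ s).2 0)) t ∧
        (∀ a, ((n : ℝ) + 1) * momentum (β t).2 (Fin.last n) a =
          dLdy L (γ t) (Fin.last n) a) ∧
        (∀ (w : Fin n) (a : Fin m), ((w : ℕ) + 1) * momentum (β t).2 w.castSucc a =
          dLdy L (γ t) w.castSucc a - deriv (fun s => momentum (β s).2 w.succ a) t) ∧
        (∀ i a, momentum (β t).2 i a = jacobiOstrogradski L γ i a t) ∧
        (∀ a, deriv (fun s => momentum (β s).2 0 a) t =
          ∑ i, rhoCoeff A (γ t).1 a i * dLdx L (γ t) i +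
          ∑ b, ∑ c, (γ t).2 0 b * structureCoeff A (γ t).1 b a c * momentum (β t).2 0 c) := by
  have hd : ∀ t ∈ J, DifferentiableAt ℝ β t := fun t ht => differentiableAt_of_contDiffOn hJ hβ ht
  constructor
  · intro h
    have hm : ∀ t ∈ J, γ t ∈ jetBundle U (Fin m → ℝ) (n + 1) := fun t ht => (h t ht).1
    have hr := fun t ht => (isTulczyjewRelated_iff A hU L (hm t ht) _ _).1 (h t ht)
    have hb := fun t ht => (hr t ht).1
    obtain ⟨hA, hj⟩ := (base_relation_iff A hJ hβ hb).1 fun t ht =>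
      ⟨(hr t ht).2.1, (hr t ht).2.2.1⟩
    have hrec : ∀ t ∈ J, ∀ (w : Fin n) (a : Fin m), ((w : ℝ) + 1) * momentum (β t).2 w.castSucc a =
        dLdy L (γ t) w.castSucc a - deriv (fun s => momentum (β s).2 w.succ a) t := by
      intro t ht w a
      rw [deriv_momentum (hd t ht), (hr t ht).2.2.2.2.1]
      ring
    -- Induction downwards from the slot `n`, whose momentum `π^1` is given without differentiation.
    have hJO : ∀ i : Fin (n + 1), ∀ a, ∀ t ∈ J,
        momentum (β t).2 i a = jacobiOstrogradski L γ i a t := by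
      intro i a
      induction i using Fin.reverseInduction with
      | last =>
        intro t ht
        have h2 : ((n : ℝ) + 1) ≠ 0 := by positivity
        apply mul_left_cancel₀ h2
        rw [mul_jacobiOstrogradski_last, (hr t ht).2.2.2.1]
      | cast w ih =>
        intro t ht
        -- The existence of `w : Fin n` forces `k ≥ 2`, so `γ` is smooth. For `k = 1` this case does
        -- not arise, and no regularity of `γ` is needed.
        have hγ := contDiffOn_of_base_relation hJ hβ hb (fun t ht => (hr t ht).2.2.1) w.pos
        have h2 : ((w : ℝ) + 1) ≠ 0 := by positivity
        apply mul_left_cancel₀ h2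
        rw [mul_jacobiOstrogradski_castSucc hJ (fun j => contDiffOn_dLdy hU hL hγ hm j a) w ht,
          hrec t ht, deriv_eq_of_eqOn hJ ih ht]
    refine ⟨hA, fun t ht => ⟨hm t ht, hb t ht, hj t ht, (hr t ht).2.2.2.1, hrec t ht,
      fun i a => hJO i a t ht, fun a => ?_⟩⟩
    rw [deriv_momentum (hd t ht), (hr t ht).2.2.2.2.2]
  · rintro ⟨hA, h⟩ t ht
    have hbase := (base_relation_iff A hJ hβ fun t ht => (h t ht).2.1).2
      ⟨hA, fun t ht => (h t ht).2.2.1⟩ t ht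
    -- The recursion alone suffices here; the closed form of the momenta is redundant.
    obtain ⟨h1, h2, -, h4, h5, -, h7⟩ := h t ht
    refine (isTulczyjewRelated_iff A hU L h1 _ _).2 ⟨h2, hbase.1, hbase.2, h4, fun w a => ?_,
      fun a => ?_⟩
    · rw [h5, deriv_momentum (hd t ht)]
      ring
    · rw [← deriv_momentum (hd t ht), h7]

/-- The element of the dual of the fibre of `D(A^k)` with given momenta. -/
noncomputable def covectorOfMomenta (f : Fin (n + 1) → Fin m → ℝ) :
    (Fin (n + 1) → Fin m → ℝ) →L[ℝ] ℝ :=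
  ∑ i, ∑ a, f i a • (ContinuousLinearMap.proj (R := ℝ) (φ := fun _ : Fin m => ℝ) a).comp
    (ContinuousLinearMap.proj (φ := fun _ : Fin (n + 1) => Fin m → ℝ) i)

theorem momentum_covectorOfMomenta (f : Fin (n + 1) → Fin m → ℝ) (j : Fin (n + 1)) (a : Fin m) :
    momentum (covectorOfMomenta f) j a = f j a := by
  simp only [momentum, covectorOfMomenta, FunLike.coe_sum, Finset.sum_apply,
    smul_apply, ContinuousLinearMap.comp_apply,
    ContinuousLinearMap.proj_apply, smul_eq_mul]
  rw [Finset.sum_eq_single j, Finset.sum_eq_single a]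
  · simp
  · intro c _ hc
    simp [hc]
  · simp
  · intro i _ hi
    simp [hi]
  · simp

/-- The `k`-th order Euler–Lagrange equations. -/
theorem satisfiesEulerLagrange_iff (A : LieAlgebroid U (Fin m → ℝ)) (hU : IsOpen U)
    {L : JetSpace (Fin d → ℝ) (Fin m → ℝ) (n + 1) → ℝ}
    (hL : ContDiffOn ℝ ∞ L (jetBundle U (Fin m → ℝ) (n + 1))) (hJ : IsOpen J)
    {γ : ℝ → JetSpace (Fin d → ℝ) (Fin m → ℝ) (n + 1)} (hγ : ContDiffOn ℝ ∞ γ J)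
    (hm : ∀ t ∈ J, γ t ∈ jetBundle U (Fin m → ℝ) (n + 1)) :
    SatisfiesEulerLagrange A L J γ ↔
      IsAdmissible A J (fun s => ((γ s).1, (γ s).2 0)) ∧
      ∀ t ∈ J, γ t = jet (n + 1) (fun s => ((γ s).1, (γ s).2 0)) t ∧
        ∀ a, ∑ i, rhoCoeff A (γ t).1 a i * dLdx L (γ t) i -
          (deriv (jacobiOstrogradski L γ 0 a) t -
            ∑ b, ∑ c, (γ t).2 0 b * structureCoeff A (γ t).1 b a c *
              jacobiOstrogradski L γ 0 c t) = 0 := by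
  have hs := fun a j => contDiffOn_dLdy hU hL hγ hm j a
  constructor
  · rintro ⟨β, hβ, h⟩
    obtain ⟨hA, h⟩ := (isRelatedToProlongation_iff A hU hL hJ hβ γ).1 h
    refine ⟨hA, fun t ht => ?_⟩
    obtain ⟨-, -, h3, -, -, h6, h7⟩ := h t ht
    refine ⟨h3, fun a => ?_⟩
    have h8 : EqOn (fun s => momentum (β s).2 0 a) (jacobiOstrogradski L γ 0 a) J :=
      fun s hs => (h s hs).2.2.2.2.2.1 0 a
    rw [← deriv_eq_of_eqOn hJ h8 ht, h7]
    simp only [h6]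
    ring
  · rintro ⟨hA, h⟩
    -- The curve `β` is forced by `γ`: its base is the lower jet and its momenta are the
    -- Jacobi–Ostrogradski sums.
    have hβ : ContDiffOn ℝ ∞ (fun t => (((γ t).1, fun w : Fin n => (γ t).2 w.castSucc),
        covectorOfMomenta fun i a => jacobiOstrogradski L γ i a t)) J := by
      refine (hγ.fst.prodMk (contDiffOn_pi.2 fun w => contDiffOn_pi.1 hγ.snd _)).prodMk ?_
      exact ContDiffOn.sum fun i _ => ContDiffOn.sum fun a _ =>
        (contDiffOn_jacobiOstrogradski hJ (hs a) i).smul (contDiffOn_const (𝕜 := ℝ))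
    refine ⟨_, hβ, (isRelatedToProlongation_iff A hU hL hJ hβ γ).2 ⟨hA, fun t ht => ?_⟩⟩
    simp only [momentum_covectorOfMomenta]
    refine ⟨hm t ht, trivial, (h t ht).1, fun a => mul_jacobiOstrogradski_last L γ a t,
      fun w a => mul_jacobiOstrogradski_castSucc hJ (hs a) w ht, fun _ _ => trivial, fun a => ?_⟩
    have := (h t ht).2 a
    exact (eq_of_sub_eq_zero (by linarith)).symm

end Coordinates

/-! ### Tangent bundles and Lie algebras. -/

section SpecialCases

variable {d m n : ℕ} {J : Set ℝ}

/-- In terms of unnormalised derivatives the chain rule makes `∂L/∂y_{j+1}` equal to `(j+1)!` times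
the usual partial derivative, and this factor cancels the weight in the sum. -/
theorem jacobiOstrogradski_zero_eqOn (hJ : IsOpen J)
    {L : JetSpace (Fin d → ℝ) (Fin m → ℝ) (n + 1) → ℝ}
    {γ : ℝ → JetSpace (Fin d → ℝ) (Fin m → ℝ) (n + 1)} {a : Fin m} {g : Fin (n + 1) → ℝ → ℝ}
    (h : ∀ j, ∀ t ∈ J, dLdy L (γ t) j a = (((j : ℕ) + 1).factorial : ℝ) * g j t) :
    EqOn (jacobiOstrogradski L γ 0 a)
      (fun t => ∑ j : Fin (n + 1), (-1 : ℝ) ^ (j : ℕ) * iteratedDeriv j (g j) t) J := by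
  intro t ht
  rw [jacobiOstrogradski_zero]
  refine Finset.sum_congr rfl fun j _ => ?_
  have hf : (((j : ℕ) + 1).factorial : ℝ) ≠ 0 := by positivity
  rw [Set.EqOn.iteratedDeriv_of_isOpen (fun t ht => h j t ht) hJ j ht,
    iteratedDeriv_const_mul_field]
  field_simp

theorem eq_jet_iff {γ : ℝ → JetSpace (Fin d → ℝ) (Fin m → ℝ) (n + 1)} {t : ℝ} :
    γ t = jet (n + 1) (fun s => ((γ s).1, (γ s).2 0)) t ↔
      ∀ j : Fin (n + 1), (((j : ℕ) + 1).factorial : ℝ) • (γ t).2 j =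
        iteratedDeriv (j : ℕ) (fun s => (γ s).2 0) t := by
  rw [Prod.ext_iff, funext_iff (f := (γ t).2)]
  simp only [jet, true_and]
  refine forall_congr' fun j => ?_
  have hf : (((j : ℕ) + 1).factorial : ℝ) ≠ 0 := by positivity
  rw [one_div, eq_inv_smul_iff₀ hf]

/-- The identification of `A^k` with `T^k U` for `A = TU`, in coordinates. -/
noncomputable def toHigherTangent (d n : ℕ) :
    JetSpace (Fin d → ℝ) (Fin d → ℝ) (n + 1) →L[ℝ] (Fin (n + 2) → Fin d → ℝ) where
  toFun p := Fin.cons p.1 fun j => (((j : ℕ) + 1).factorial : ℝ) • p.2 j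
  map_add' p p' := by
    ext1 j
    refine Fin.cases ?_ (fun i => ?_) j <;> simp
  map_smul' c p := by
    ext1 j
    refine Fin.cases ?_ (fun i => ?_) j
    · simp
    · simp [smul_comm c]
  cont := by
    refine continuous_pi fun j => ?_
    refine Fin.cases ?_ (fun i => ?_) j
    · simpa using continuous_fst
    · simp only [Fin.cons_succ]
      fun_prop

theorem toHigherTangent_inl (x : Fin d → ℝ) :
    toHigherTangent d n (x, 0) = Pi.single 0 x := by
  ext1 j
  refine Fin.cases ?_ (fun i => ?_) j <;> simp [toHigherTangent]

theorem toHigherTangent_single (j : Fin (n + 1)) (y : Fin d → ℝ) :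
    toHigherTangent d n (0, Pi.single j y) =
      (((j : ℕ) + 1).factorial : ℝ) • Pi.single j.succ y := by
  ext1 i
  refine Fin.cases ?_ (fun i => ?_) i
  · simp [toHigherTangent]
  · rcases eq_or_ne i j with rfl | h
    · simp [toHigherTangent]
    · simp [toHigherTangent, h]

/-- The higher-order Euler–Lagrange equations on the tangent bundle. -/
theorem satisfiesEulerLagrange_tangent_iff {U : Set (Fin d → ℝ)} (hU : IsOpen U)
    {ℒ : (Fin (n + 2) → Fin d → ℝ) → ℝ} (hℒ : ContDiffOn ℝ ∞ ℒ {z | z 0 ∈ U}) (hJ : IsOpen J)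
    {γ : ℝ → JetSpace (Fin d → ℝ) (Fin d → ℝ) (n + 1)} (hγ : ContDiffOn ℝ ∞ γ J)
    (hm : ∀ t ∈ J, γ t ∈ jetBundle U (Fin d → ℝ) (n + 1)) :
    SatisfiesEulerLagrange (tangentAlgebroid hU)
        (fun p => ℒ (Fin.cons p.1 fun j => (((j : ℕ) + 1).factorial : ℝ) • p.2 j)) J γ ↔
      ∀ t ∈ J,
        (∀ j : Fin (n + 1), (((j : ℕ) + 1).factorial : ℝ) • (γ t).2 j =
          iteratedDeriv ((j : ℕ) + 1) (fun s => (γ s).1) t) ∧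
        ∀ a, ∑ j : Fin (n + 2), (-1 : ℝ) ^ (j : ℕ) *
          iteratedDeriv j (fun τ => fderiv ℝ ℒ
            (fun i => iteratedDeriv i (fun s => (γ s).1) τ)
            (Pi.single j (Pi.single a 1))) t = 0 := by
  set L : JetSpace (Fin d → ℝ) (Fin d → ℝ) (n + 1) → ℝ := fun p => ℒ (toHigherTangent d n p)
    with hLdef
  change SatisfiesEulerLagrange (tangentAlgebroid hU) L J γ ↔ _
  have hmaps : MapsTo (toHigherTangent d n) (jetBundle U (Fin d → ℝ) (n + 1)) {z | z 0 ∈ U} :=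
    fun p hp => hp
  have hL : ContDiffOn ℝ ∞ L (jetBundle U (Fin d → ℝ) (n + 1)) :=
    hℒ.comp (toHigherTangent d n).contDiff.contDiffOn hmaps
  have hB : IsOpen {z : Fin (n + 2) → Fin d → ℝ | z 0 ∈ U} := hU.preimage (continuous_apply 0)
  have hfd : ∀ q ∈ jetBundle U (Fin d → ℝ) (n + 1), ∀ w,
      fderiv ℝ L q w = fderiv ℝ ℒ (toHigherTangent d n q) (toHigherTangent d n w) := by
    intro q hq w
    have h : DifferentiableAt ℝ ℒ (toHigherTangent d n q) :=
      (hℒ.contDiffAt (hB.mem_nhds (hmaps hq))).differentiableAt (by simp)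
    have h2 : HasFDerivAt L _ q := h.hasFDerivAt.comp q (toHigherTangent d n).hasFDerivAt
    rw [h2.fderiv]
    rfl
  have hx : ∀ t ∈ J, DifferentiableAt ℝ (fun s => (γ s).1) t := fun t ht =>
    differentiableAt_of_contDiffOn hJ hγ.fst ht
  -- For `TU` admissibility means `y₁ = x'`, so derivatives of `y₁` are derivatives of `x` of one
  -- order higher; the case `j = 0` on the right returns admissibility.
  have hbase : (IsAdmissible (tangentAlgebroid hU) J (fun s => ((γ s).1, (γ s).2 0)) ∧
      ∀ t ∈ J, γ t = jet (n + 1) (fun s => ((γ s).1, (γ s).2 0)) t) ↔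
      ∀ t ∈ J, ∀ j : Fin (n + 1), (((j : ℕ) + 1).factorial : ℝ) • (γ t).2 j =
          iteratedDeriv ((j : ℕ) + 1) (fun s => (γ s).1) t := by
    simp only [eq_jet_iff]
    have hder : (∀ t ∈ J, deriv (fun s => (γ s).1) t = (γ t).2 0) →
        ∀ t ∈ J, ∀ k : ℕ, iteratedDeriv (k + 1) (fun s => (γ s).1) t =
          iteratedDeriv k (fun s => (γ s).2 0) t := by
      intro h t ht k
      rw [iteratedDeriv_succ']
      exact Set.EqOn.iteratedDeriv_of_isOpen (fun t ht => h t ht) hJ k ht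
    constructor
    · rintro ⟨hA, h⟩ t ht j
      rw [h t ht, hder (fun t ht => (hA t ht).deriv) t ht]
    · intro h
      have h0 : ∀ t ∈ J, deriv (fun s => (γ s).1) t = (γ t).2 0 := by
        intro t ht
        simpa using (h t ht 0).symm
      refine ⟨fun t ht => ?_, fun t ht j => ?_⟩
      · have := (hx t ht).hasDerivAt
        rw [h0 t ht] at this
        exact this
      · rw [h t ht, hder h0 t ht]
  rw [satisfiesEulerLagrange_iff _ hU hL hJ hγ hm, forall₂_and, ← and_assoc, hbase, ← forall₂_and]
  rw [forall₂_and, forall₂_and]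
  refine and_congr_right fun hj => forall₂_congr fun t ht => forall_congr' fun a => ?_
  have hpt : ∀ t ∈ J, toHigherTangent d n (γ t) =
      fun i : Fin (n + 2) => iteratedDeriv i (fun s => (γ s).1) t := by
    intro t ht
    ext1 i
    refine Fin.cases ?_ (fun i => ?_) i
    · simp [toHigherTangent]
    · exact hj t ht i
  set g : Fin (n + 2) → ℝ → ℝ := fun j τ => fderiv ℝ ℒ
    (fun i => iteratedDeriv i (fun s => (γ s).1) τ) (Pi.single j (Pi.single a 1)) with hg
  have hdy : ∀ j : Fin (n + 1), ∀ t ∈ J,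
      dLdy L (γ t) j a = (((j : ℕ) + 1).factorial : ℝ) * g j.succ t := by
    intro j t ht
    rw [dLdy, hfd _ (hm t ht), toHigherTangent_single, map_smul, hpt t ht, smul_eq_mul]
  -- Smoothness is inherited from `dLdy` by dividing by the factorial. Only successor indices are
  -- needed: `g 0` is never differentiated.
  have hgs : ∀ j : Fin (n + 1), ContDiffOn ℝ ∞ (g j.succ) J := by
    intro j
    have hf : (((j : ℕ) + 1).factorial : ℝ) ≠ 0 := by positivity
    refine (contDiffOn_const.mul (contDiffOn_dLdy hU hL hγ hm j a)
      (f := fun _ => (((j : ℕ) + 1).factorial : ℝ)⁻¹)).congr fun t ht => ?_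
    rw [hdy j t ht, inv_mul_cancel_left₀ hf]
  have hρ : ∑ i, rhoCoeff (tangentAlgebroid hU) (γ t).1 a i * dLdx L (γ t) i = g 0 t := by
    have h1 : ∀ i, rhoCoeff (tangentAlgebroid hU) (γ t).1 a i =
        (Pi.single a (1 : ℝ) : Fin d → ℝ) i := fun i => rfl
    rw [Finset.sum_eq_single a]
    · rw [h1, Pi.single_eq_same, one_mul, dLdx, hfd _ (hm t ht), toHigherTangent_inl, hpt t ht]
    · intro i _ hi
      rw [h1, Pi.single_eq_of_ne hi, zero_mul]
    · simp
  -- The frame is constant, so its Lie brackets vanish.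
  have hC : ∀ x b c, structureCoeff (tangentAlgebroid hU) x b a c = 0 := by
    intro x b c
    simp [structureCoeff, tangentAlgebroid, VectorField.lieBracket]
  rw [hρ, deriv_eq_of_eqOn hJ (jacobiOstrogradski_zero_eqOn hJ hdy) ht,
    deriv_fun_sum fun j _ => (differentiableAt_of_contDiffOn hJ
      (contDiffOn_iteratedDeriv hJ (hgs j) j) ht).const_mul _]
  -- The outer time derivative raises every order by one, which shifts the index and flips the sign;
  -- `g 0` then supplies the missing term of order zero.
  have hsum : ∑ j : Fin (n + 1), deriv (fun y => (-1 : ℝ) ^ (j : ℕ) *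
      iteratedDeriv j (g j.succ) y) t =
      -∑ j : Fin (n + 1), (-1 : ℝ) ^ (j.succ : ℕ) * iteratedDeriv j.succ (g j.succ) t := by
    rw [← Finset.sum_neg_distrib]
    refine Finset.sum_congr rfl fun j _ => ?_
    rw [deriv_const_mul_field, Fin.val_succ, iteratedDeriv_succ, pow_succ]
    ring
  change _ ↔ ∑ j : Fin (n + 2), (-1 : ℝ) ^ (j : ℕ) * iteratedDeriv j (g j) t = 0
  rw [hsum, Fin.sum_univ_succ (n := n + 1)]
  simp only [hC, mul_zero, zero_mul, Finset.sum_const_zero, sub_zero, sub_neg_eq_add,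
    Fin.val_zero, pow_zero, one_mul, iteratedDeriv_zero]

/-- The higher-order Euler–Poincaré equations. -/
theorem satisfiesEulerLagrange_lieAlgebra_iff {𝔤 : Type*} [LieRing 𝔤] [LieAlgebra ℝ 𝔤]
    (e : Module.Basis (Fin m) ℝ 𝔤) {ℓ : (Fin (n + 1) → Fin m → ℝ) → ℝ} (hℓ : ContDiff ℝ ∞ ℓ)
    (hJ : IsOpen J) {γ : ℝ → JetSpace (Fin 0 → ℝ) (Fin m → ℝ) (n + 1)}
    (hγ : ContDiffOn ℝ ∞ γ J) :
    SatisfiesEulerLagrange (ofLieAlgebra e)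
        (fun p => ℓ fun j => (((j : ℕ) + 1).factorial : ℝ) • p.2 j) J γ ↔
      ∀ t ∈ J,
        (∀ j : Fin (n + 1), (((j : ℕ) + 1).factorial : ℝ) • (γ t).2 j =
          iteratedDeriv (j : ℕ) (fun s => (γ s).2 0) t) ∧
        ∀ a, deriv (fun s => ∑ j : Fin (n + 1), (-1 : ℝ) ^ (j : ℕ) *
            iteratedDeriv j (fun τ => fderiv ℝ ℓ
              (fun i => iteratedDeriv i (fun s => (γ s).2 0) τ)
              (Pi.single j (Pi.single a 1))) s) t =
          ∑ b, ∑ c, (γ t).2 0 b * e.repr ⁅e b, e a⁆ c *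
            ∑ j : Fin (n + 1), (-1 : ℝ) ^ (j : ℕ) *
              iteratedDeriv j (fun τ => fderiv ℝ ℓ
                (fun i => iteratedDeriv i (fun s => (γ s).2 0) τ)
                (Pi.single j (Pi.single c 1))) t := by
  let S : JetSpace (Fin 0 → ℝ) (Fin m → ℝ) (n + 1) →L[ℝ] (Fin (n + 1) → Fin m → ℝ) :=
    (ContinuousLinearMap.pi fun j : Fin (n + 1) => (((j : ℕ) + 1).factorial : ℝ) •
      ContinuousLinearMap.proj (R := ℝ) (φ := fun _ : Fin (n + 1) => Fin m → ℝ) j).comp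
      (ContinuousLinearMap.snd ℝ _ _)
  have hS : ∀ p j, S p j = (((j : ℕ) + 1).factorial : ℝ) • p.2 j := fun p j => rfl
  set L : JetSpace (Fin 0 → ℝ) (Fin m → ℝ) (n + 1) → ℝ := fun p => ℓ (S p) with hLdef
  change SatisfiesEulerLagrange (ofLieAlgebra e) L J γ ↔ _
  have hL : ContDiffOn ℝ ∞ L (jetBundle univ (Fin m → ℝ) (n + 1)) :=
    (hℓ.comp S.contDiff).contDiffOn
  have hfd : ∀ q w, fderiv ℝ L q w = fderiv ℝ ℓ (S q) (S w) := by
    intro q w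
    have h : DifferentiableAt ℝ ℓ (S q) := hℓ.differentiable (by simp) _
    have h2 : HasFDerivAt L _ q := h.hasFDerivAt.comp q S.hasFDerivAt
    rw [h2.fderiv]
    rfl
  -- Over a point every curve is admissible.
  have hA : IsAdmissible (ofLieAlgebra e) J (fun s => ((γ s).1, (γ s).2 0)) := by
    intro t _
    have h : (fun s => (γ s).1) = fun _ => 0 := Subsingleton.elim _ _
    change HasDerivAt (fun s => (γ s).1) 0 t
    rw [h]
    exact hasDerivAt_const t _
  have hC : ∀ x b a c, structureCoeff (ofLieAlgebra e) x b a c = e.repr ⁅e b, e a⁆ c := by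
    intro x b a c
    have h : ∀ b, e.equivFun.symm (Pi.single b 1) = e b := fun b => by
      simp [Module.Basis.equivFun_symm_apply, Pi.single_apply]
    simp only [structureCoeff, ofLieAlgebra, h]
    rfl
  rw [satisfiesEulerLagrange_iff _ isOpen_univ hL hJ hγ fun _ _ => mem_univ _, and_iff_right hA]
  simp only [eq_jet_iff]
  rw [forall₂_and, forall₂_and]
  refine and_congr_right fun hj => forall₂_congr fun t ht => forall_congr' fun a => ?_
  have hpt : ∀ t ∈ J, S (γ t) =
      fun i : Fin (n + 1) => iteratedDeriv i (fun s => (γ s).2 0) t := fun t ht =>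
    funext fun j => hj t ht j
  have hdy : ∀ a, ∀ j : Fin (n + 1), ∀ t ∈ J, dLdy L (γ t) j a = (((j : ℕ) + 1).factorial : ℝ) *
      fderiv ℝ ℓ (fun i => iteratedDeriv i (fun s => (γ s).2 0) t)
        (Pi.single j (Pi.single a 1)) := by
    intro a j t ht
    have h1 : S (0, Pi.single j (Pi.single a 1)) =
        (((j : ℕ) + 1).factorial : ℝ) • Pi.single j (Pi.single a 1) := by
      ext1 i
      rcases eq_or_ne i j with rfl | h
      · simp [hS]
      · simp [hS, h]
    rw [dLdy, hfd, h1, map_smul, hpt t ht, smul_eq_mul]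
  have hJO := fun a => jacobiOstrogradski_zero_eqOn hJ (hdy a)
  rw [deriv_eq_of_eqOn hJ (hJO a) ht]
  -- The anchor term is a sum over `Fin 0`, hence empty.
  simp only [hJO _ ht, hC, Finset.univ_eq_empty, Finset.sum_empty, zero_sub, neg_eq_zero,
    sub_eq_zero]

end SpecialCases
end LieAlgebroidMechanics

theorem mainTheorem3 (n d m : ℕ) :
    -- the general case: `k = n + 1`, Lie algebroid over an open set `U ⊂ ℝ^d`, of rank `m`
    (∀ (U : Set (Fin d → ℝ)) (A : LieAlgebroid U (Fin m → ℝ))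
      (L : JetSpace (Fin d → ℝ) (Fin m → ℝ) (n + 1) → ℝ) (J : Set ℝ),
      IsOpen U → ContDiffOn ℝ ∞ L (jetBundle U (Fin m → ℝ) (n + 1)) → IsOpen J →
      -- the weighted Tulczyjew differential in coordinates
      (∀ q ∈ jetBundle U (Fin m → ℝ) (n + 1), ∀ b v : DDualSpace (Fin d → ℝ) (Fin m → ℝ) n,
        IsTulczyjewRelated A L q b v ↔
          b.1 = (q.1, fun w => q.2 w.castSucc) ∧
          (∀ i, v.1.1 i = ∑ a, rhoCoeff A q.1 a i * q.2 0 a) ∧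
          (∀ (w : Fin n) (a : Fin m), v.1.2 w a = ((w : ℕ) + 2) * q.2 w.succ a) ∧
          (∀ a, ((n : ℝ) + 1) * momentum b.2 (Fin.last n) a = dLdy L q (Fin.last n) a) ∧
          (∀ (w : Fin n) (a : Fin m), momentum v.2 w.succ a =
            dLdy L q w.castSucc a - ((w : ℕ) + 1) * momentum b.2 w.castSucc a) ∧
          (∀ a, momentum v.2 0 a = ∑ i, rhoCoeff A q.1 a i * dLdx L q i +
            ∑ b', ∑ c, q.2 0 b' * structureCoeff A q.1 b' a c * momentum b.2 0 c)) ∧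
      -- solutions of the phase dynamics
      (∀ β : ℝ → DDualSpace (Fin d → ℝ) (Fin m → ℝ) n,
        (∀ t ∈ J, (β t, deriv β t) ∈ phaseDynamics A L) ↔
          ∃ γ, IsRelatedToProlongation A L J γ β) ∧
      (∀ β : ℝ → DDualSpace (Fin d → ℝ) (Fin m → ℝ) n, ContDiffOn ℝ ∞ β J →
        ∀ γ : ℝ → JetSpace (Fin d → ℝ) (Fin m → ℝ) (n + 1),
        IsRelatedToProlongation A L J γ β ↔
          IsAdmissible A J (fun s => ((γ s).1, (γ s).2 0)) ∧
          ∀ t ∈ J, γ t ∈ jetBundle U (Fin m → ℝ) (n + 1) ∧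
            (β t).1 = ((γ t).1, fun w => (γ t).2 w.castSucc) ∧
            γ t = jet (n + 1) (fun s => ((γ s).1, (γ s).2 0)) t ∧
            -- the momenta, recursively and in closed form
            (∀ a, ((n : ℝ) + 1) * momentum (β t).2 (Fin.last n) a =
              dLdy L (γ t) (Fin.last n) a) ∧
            (∀ (w : Fin n) (a : Fin m), ((w : ℕ) + 1) * momentum (β t).2 w.castSucc a =
              dLdy L (γ t) w.castSucc a - deriv (fun s => momentum (β s).2 w.succ a) t) ∧
            (∀ i a, momentum (β t).2 i a = jacobiOstrogradski L γ i a t) ∧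
            -- the remaining equation
            (∀ a, deriv (fun s => momentum (β s).2 0 a) t =
              ∑ i, rhoCoeff A (γ t).1 a i * dLdx L (γ t) i +
              ∑ b, ∑ c, (γ t).2 0 b * structureCoeff A (γ t).1 b a c * momentum (β t).2 0 c)) ∧
      -- the `k`-th order Euler–Lagrange equations
      (∀ γ : ℝ → JetSpace (Fin d → ℝ) (Fin m → ℝ) (n + 1), ContDiffOn ℝ ∞ γ J →
        (∀ t ∈ J, γ t ∈ jetBundle U (Fin m → ℝ) (n + 1)) →
        (SatisfiesEulerLagrange A L J γ ↔
          IsAdmissible A J (fun s => ((γ s).1, (γ s).2 0)) ∧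
          ∀ t ∈ J, γ t = jet (n + 1) (fun s => ((γ s).1, (γ s).2 0)) t ∧
            ∀ a, ∑ i, rhoCoeff A (γ t).1 a i * dLdx L (γ t) i -
              (deriv (fun s => ∑ j : Fin (n + 1), (-1 : ℝ) ^ (j : ℕ) *
                  (1 / (((j : ℕ) + 1).factorial : ℝ)) *
                  iteratedDeriv j (fun τ => dLdy L (γ τ) j a) s) t -
                ∑ b, ∑ c, (γ t).2 0 b * structureCoeff A (γ t).1 b a c *
                  ∑ j : Fin (n + 1), (-1 : ℝ) ^ (j : ℕ) *
                    (1 / (((j : ℕ) + 1).factorial : ℝ)) *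
                    iteratedDeriv j (fun τ => dLdy L (γ τ) j c) t) = 0))) ∧
    -- the tangent bundle: a Lagrangian `ℒ(q, q', …, q^{(k)})` on `T^k U`
    (∀ (U : Set (Fin d → ℝ)) (hU : IsOpen U) (ℒ : (Fin (n + 2) → Fin d → ℝ) → ℝ) (J : Set ℝ),
      ContDiffOn ℝ ∞ ℒ {z | z 0 ∈ U} → IsOpen J →
      ∀ γ : ℝ → JetSpace (Fin d → ℝ) (Fin d → ℝ) (n + 1), ContDiffOn ℝ ∞ γ J →
        (∀ t ∈ J, γ t ∈ jetBundle U (Fin d → ℝ) (n + 1)) →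
        (SatisfiesEulerLagrange (tangentAlgebroid hU)
            (fun p => ℒ (Fin.cons p.1 fun j => (((j : ℕ) + 1).factorial : ℝ) • p.2 j)) J γ ↔
          ∀ t ∈ J,
            (∀ j : Fin (n + 1), (((j : ℕ) + 1).factorial : ℝ) • (γ t).2 j =
              iteratedDeriv ((j : ℕ) + 1) (fun s => (γ s).1) t) ∧
            ∀ a, ∑ j : Fin (n + 2), (-1 : ℝ) ^ (j : ℕ) *
              iteratedDeriv j (fun τ => fderiv ℝ ℒ
                (fun i => iteratedDeriv i (fun s => (γ s).1) τ)
                (Pi.single j (Pi.single a 1))) t = 0)) ∧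
    -- a Lie algebra: a Lagrangian `ℓ(ξ, ξ', …, ξ^{(k-1)})`
    (∀ (𝔤 : Type*) [LieRing 𝔤] [LieAlgebra ℝ 𝔤] (e : Module.Basis (Fin m) ℝ 𝔤)
      (ℓ : (Fin (n + 1) → Fin m → ℝ) → ℝ) (J : Set ℝ), ContDiff ℝ ∞ ℓ → IsOpen J →
      ∀ γ : ℝ → JetSpace (Fin 0 → ℝ) (Fin m → ℝ) (n + 1), ContDiffOn ℝ ∞ γ J →
        (SatisfiesEulerLagrange (ofLieAlgebra e)
            (fun p => ℓ fun j => (((j : ℕ) + 1).factorial : ℝ) • p.2 j) J γ ↔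
          ∀ t ∈ J,
            (∀ j : Fin (n + 1), (((j : ℕ) + 1).factorial : ℝ) • (γ t).2 j =
              iteratedDeriv (j : ℕ) (fun s => (γ s).2 0) t) ∧
            ∀ a, deriv (fun s => ∑ j : Fin (n + 1), (-1 : ℝ) ^ (j : ℕ) *
                iteratedDeriv j (fun τ => fderiv ℝ ℓ
                  (fun i => iteratedDeriv i (fun s => (γ s).2 0) τ)
                  (Pi.single j (Pi.single a 1))) s) t =
              ∑ b, ∑ c, (γ t).2 0 b * e.repr ⁅e b, e a⁆ c *
                ∑ j : Fin (n + 1), (-1 : ℝ) ^ (j : ℕ) *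
                  iteratedDeriv j (fun τ => fderiv ℝ ℓ
                    (fun i => iteratedDeriv i (fun s => (γ s).2 0) τ)
                    (Pi.single j (Pi.single c 1))) t)) := by
  
  refine ⟨fun U A L J hU hL hJ => ⟨fun q hq b v => isTulczyjewRelated_iff A hU L hq b v,
      fun β => ?_, fun β hβ γ => isRelatedToProlongation_iff A hU hL hJ hβ γ,
      fun γ hγ hm => ?_⟩,
    fun U hU ℒ J hℒ hJ γ hγ hm => satisfiesEulerLagrange_tangent_iff hU hℒ hJ hγ hm,
    fun 𝔤 _ _ e ℓ J hℓ hJ γ hγ => satisfiesEulerLagrange_lieAlgebra_iff e hℓ hJ hγ⟩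
  · constructor
    · intro h
      -- A pointwise choice is enough, since the relation asks for no regularity of `γ`; values
      -- outside `J` are arbitrary.
      choose! γ hγ using h
      exact ⟨γ, hγ⟩
    · rintro ⟨γ, hγ⟩ t ht
      exact ⟨γ t, hγ t ht⟩
  · rw [satisfiesEulerLagrange_iff A hU hL hJ hγ hm]
    simp only [jacobiOstrogradski_zero]
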